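/- Let $n \ge 2$. For a unit vector $v \in \mathbb R^n$ and a (complex-valued) Schwartz function $f$ on $\mathbb R^n$ let \[ \mathscr H_v f(x) = \frac1\pi \lim_{\epsilon \to 0^+} \int_{|t|>\epsilon} f(x - tv)\,\frac{dt}{t}, \qquad x \in \mathbb R^n, \] be the directional Hilbert transform, and for a set $U$ of unit vectors let \[ \mathscr H_U f(x) = \sup_{v \in U} |\mathscr H_v f(x)| \] be the associated maximal directional Hilbert transform. If $U$ is infinite, then for no $p$ with $1 < p < \infty$ can $\mathscr H_U$ be extended from the Schwartz functions to a bounded operator on $L^p(\mathbb R^n)$: there is no map (linear or not) $T : L^p(\mathbb R^n) \to L^p(\mathbb R^n)$ such that, for some constant $C$, $\|Tg\|_p \le C \|g\|_p$ for all $g \in L^p(\mathbb R^n)$, and $Tf = \mathscr H_U f$ almost everywhere for every Schwartz function $f$. -/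

import Mathlib

open MeasureTheory Filter Topology SchwartzMap
open scoped ENNReal

noncomputable section

/-- The directional Hilbert transform of a Schwartz function on `ℝⁿ` in the direction `v`:
`H_v f (x) = (1/π) lim_{ε → 0⁺} ∫_{|t| > ε} f (x - t v) dt / t`. -/
def directionalHilbert {n : ℕ} (v : EuclideanSpace ℝ (Fin n))
    (f : 𝓢(EuclideanSpace ℝ (Fin n), ℂ)) (x : EuclideanSpace ℝ (Fin n)) : ℂ :=
  (1 / (Real.pi : ℂ)) *
    limUnder (𝓝[>] (0 : ℝ)) (fun ε : ℝ => ∫ t in {t : ℝ | ε < |t|}, f (x - t • v) / (t : ℂ))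

/-- The maximal directional Hilbert transform of a Schwartz function over a set `U` of directions:
`H_U f (x) = sup_{v ∈ U} |H_v f (x)|`, a supremum taken in `[0, ∞]`. -/
def maximalDirectionalHilbert {n : ℕ} (U : Set (EuclideanSpace ℝ (Fin n)))
    (f : 𝓢(EuclideanSpace ℝ (Fin n), ℂ)) (x : EuclideanSpace ℝ (Fin n)) : ℝ≥0∞ :=
  ⨆ v ∈ U, ‖directionalHilbert v f x‖ₑ

/-- `H_U`, given on Schwartz functions, extends to a bounded operator on `L^p(ℝⁿ)`: there are a
map `T : L^p → L^p` and a constant `C` with `‖T g‖_p ≤ C ‖g‖_p` for all `g ∈ L^p`, such that for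
every Schwartz function `f`, `H_U f` is finite and equal to `T f` almost everywhere.
(`H_U` is not linear, so `T` is not required to be linear.) -/
def ExtendsToBoundedOperator {n : ℕ} (U : Set (EuclideanSpace ℝ (Fin n))) (p : ℝ≥0∞) : Prop :=
  ∃ T : Lp ℂ p (volume : Measure (EuclideanSpace ℝ (Fin n))) →
      Lp ℂ p (volume : Measure (EuclideanSpace ℝ (Fin n))),
    (∃ C : ℝ, ∀ g, ‖T g‖ ≤ C * ‖g‖) ∧
    ∀ f : 𝓢(EuclideanSpace ℝ (Fin n), ℂ),
      ∀ᵐ x ∂(volume : Measure (EuclideanSpace ℝ (Fin n))),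
        maximalDirectionalHilbert U f x ≠ ∞ ∧
          T ((f.memLp p volume).toLp f) x = ((maximalDirectionalHilbert U f x).toReal : ℂ)

end

/-!
The transform `H_v` has Fourier multiplier `-i sgn ⟪ξ, v⟫`. Hence if `g` is a smooth bump and `R` is
large, `H_v (g cos (R ⟪μ, ·⟫))` is close to `g sin (R ⟪μ, ·⟫)` when `⟪μ, v⟫ > 0` and to its negative
when `⟪μ, v⟫ < 0` (`tendsto_integral_abs_lineHilbert_sub`, by the Riemann-Lebesgue lemma). An infinite
set of directions contains a sequence `v 0, v 1, …` such that for every `j` some frequency `μ` is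
negative on `v 0, …, v j` and positive on all later terms (`exists_separated_directions`). So the
order of the sequence acts as a list of sign patterns: the pieces of a sum `∑ f_ν` at such
frequencies are given the sign `-` or `+` in direction `v k` according to the position of `k`.

As for rearranged Haar series, the sum is arranged along a binary tree of depth `m` whose `2 ^ m`
leaves are consecutive directions in their order. On an open set `O` the root term is
`g cos (R ⟪μ, ·⟫)`, with `g` close to the indicator function of `O` and with `μ` separating the left
half of the leaves from the right half. Where `sin (R ⟪μ, ·⟫) < 0` the construction continues with the
left half, where it is positive with the right half. Whichever leaf the point `x` is led to, all
terms along its path contribute positively to the transform in that direction, about `|sin|` each,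
while the terms off its path are negligible at `x`. The maximal transform therefore has average at
least about `m / 2` on `O` (`exists_isTreeFunction`).

On the other hand `f` is bounded by `m`, and each frequency can be taken so large that the new term
is almost orthogonal to those before it, so `‖f‖₂² ≤ 2 m |O|`. Thus `f` exceeds `δ m` only on a set of
measure `O(|O| / (δ² m))`, and `‖f‖_p = o(m)` for every finite `p` (`integral_rpow_abs_le`). Letting
`m → ∞` contradicts a bound `‖H_U f‖_p ≤ C ‖f‖_p`.
-/


/-! ### Oscillatory integrals -/

section Oscillatory

open scoped FourierTransform RealInnerProductSpace

variable {V : Type*} [NormedAddCommGroup V] [InnerProductSpace ℝ V] [FiniteDimensional ℝ V]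
  [MeasurableSpace V] [BorelSpace V]

/-- The Riemann-Lebesgue lemma along a ray of frequencies. -/
theorem tendsto_integral_cexp_inner {f : V → ℝ} {μ : V} (hμ : μ ≠ 0) :
    Tendsto (fun R : ℝ => ∫ x, Complex.exp (((R * ⟪μ, x⟫ : ℝ) : ℂ) * Complex.I) * (f x : ℂ))
      atTop (𝓝 0) := by
  have h := tendsto_integral_exp_inner_smul_cocompact (V := V) (fun x => (f x : ℂ))
  have h2 : Tendsto (fun R : ℝ => (-(R / (2 * Real.pi))) • μ) atTop (cocompact V) := by
    rw [← Metric.cobounded_eq_cocompact, ← tendsto_norm_atTop_iff_cobounded]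
    simp only [norm_smul, norm_neg, norm_div, Real.norm_eq_abs]
    refine Tendsto.atTop_mul_const (norm_pos_iff.2 hμ) ?_
    refine Tendsto.atTop_div_const (by positivity) tendsto_abs_atTop_atTop
  refine (h.comp h2).congr fun R => integral_congr_ae (Eventually.of_forall fun x => ?_)
  simp only [Circle.smul_def, Real.fourierChar_apply, smul_eq_mul, inner_smul_right]
  congr 3
  rw [real_inner_comm]
  push_cast
  field_simp

theorem tendsto_integral_mul_cos {f : V → ℝ} (hf : Integrable f) {μ : V} (hμ : μ ≠ 0) :
    Tendsto (fun R : ℝ => ∫ x, f x * Real.cos (R * ⟪μ, x⟫)) atTop (𝓝 0) := by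
  have h := (Complex.continuous_re.tendsto _).comp
    (tendsto_integral_cexp_inner (f := f) hμ)
  refine h.congr fun R => ?_
  have hi : Integrable (fun x => Complex.exp (((R * ⟪μ, x⟫ : ℝ) : ℂ) * Complex.I) * (f x : ℂ)) := by
    refine hf.ofReal.bdd_mul (c := 1) (Continuous.aestronglyMeasurable (by fun_prop)) ?_
    filter_upwards with x
    rw [Complex.norm_exp_ofReal_mul_I]
  refine (integral_re hi).symm.trans ?_
  congr 1 with x
  simp only [RCLike.re_to_complex, Complex.re_mul_ofReal, Complex.exp_ofReal_mul_I_re]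
  ring

theorem tendsto_integral_mul_sin {f : V → ℝ} (hf : Integrable f) {μ : V} (hμ : μ ≠ 0) :
    Tendsto (fun R : ℝ => ∫ x, f x * Real.sin (R * ⟪μ, x⟫)) atTop (𝓝 0) := by
  have h := (Complex.continuous_im.tendsto _).comp
    (tendsto_integral_cexp_inner (f := f) hμ)
  refine h.congr fun R => ?_
  have hi : Integrable (fun x => Complex.exp (((R * ⟪μ, x⟫ : ℝ) : ℂ) * Complex.I) * (f x : ℂ)) := by
    refine hf.ofReal.bdd_mul (c := 1) (Continuous.aestronglyMeasurable (by fun_prop)) ?_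
    filter_upwards with x
    rw [Complex.norm_exp_ofReal_mul_I]
  refine (integral_im hi).symm.trans ?_
  congr 1 with x
  simp only [RCLike.im_to_complex, Complex.im_mul_ofReal, Complex.exp_ofReal_mul_I_im]
  ring

/-- The Riemann-Lebesgue lemma on the half-line, for a frequency `R * ω` with `ω ≠ 0`. -/
theorem tendsto_integral_Ioi_mul_cos {f : ℝ → ℝ} (hf : IntegrableOn f (Set.Ioi 0)) {ω : ℝ}
    (hω : ω ≠ 0) :
    Tendsto (fun R : ℝ => ∫ t in Set.Ioi 0, f t * Real.cos (R * ω * t)) atTop (𝓝 0) := by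
  refine (tendsto_integral_mul_cos (V := ℝ)
    ((integrable_indicator_iff measurableSet_Ioi).2 hf) hω).congr fun R => ?_
  rw [← integral_indicator measurableSet_Ioi]
  congr 1 with t
  by_cases ht : t ∈ Set.Ioi (0 : ℝ) <;> simp [ht, mul_comm, mul_left_comm]

theorem tendsto_integral_Ioi_mul_sin {f : ℝ → ℝ} (hf : IntegrableOn f (Set.Ioi 0)) {ω : ℝ}
    (hω : ω ≠ 0) :
    Tendsto (fun R : ℝ => ∫ t in Set.Ioi 0, f t * Real.sin (R * ω * t)) atTop (𝓝 0) := by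
  refine (tendsto_integral_mul_sin (V := ℝ)
    ((integrable_indicator_iff measurableSet_Ioi).2 hf) hω).congr fun R => ?_
  rw [← integral_indicator measurableSet_Ioi]
  congr 1 with t
  by_cases ht : t ∈ Set.Ioi (0 : ℝ) <;> simp [ht, mul_comm, mul_left_comm]

end Oscillatory

theorem integral_exp_neg_mul_cos (ω : ℝ) :
    ∫ t in Set.Ioi (0 : ℝ), Real.exp (-t) * Real.cos (ω * t) = 1 / (1 + ω ^ 2) := by
  have ha : (-1 + ω * Complex.I : ℂ).re < 0 := by simp
  have h := integral_exp_mul_complex_Ioi ha 0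
  have hi := integrableOn_exp_mul_complex_Ioi ha 0
  have h2 := integral_re hi
  rw [h] at h2
  have h3 : ∀ t : ℝ, RCLike.re (Complex.exp ((-1 + ω * Complex.I) * t))
      = Real.exp (-t) * Real.cos (ω * t) := by
    intro t
    simp [Complex.exp_re]
  simp_rw [h3] at h2
  rw [h2]
  simp [Complex.normSq_apply, Complex.div_re]
  ring

theorem abs_sin_div_le (ω : ℝ) {t : ℝ} (ht : 0 < t) : |Real.sin (ω * t) / t| ≤ |ω| := by
  rw [abs_div, abs_of_pos ht, div_le_iff₀ ht]
  calc |Real.sin (ω * t)| ≤ |ω * t| := Real.abs_sin_le_abs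
    _ = |ω| * t := by rw [abs_mul, abs_of_pos ht]

theorem integrableOn_exp_neg_mul_sin_div (ω : ℝ) :
    IntegrableOn (fun t : ℝ => Real.exp (-t) * (Real.sin (ω * t) / t)) (Set.Ioi 0) := by
  refine Integrable.mono' ((integrableOn_exp_neg_Ioi 0).mul_const |ω|)
    (Measurable.aestronglyMeasurable (by fun_prop)) ?_
  filter_upwards [ae_restrict_mem measurableSet_Ioi] with t ht
  rw [norm_mul, Real.norm_eq_abs, Real.norm_eq_abs, Real.abs_exp]
  exact mul_le_mul_of_nonneg_left (abs_sin_div_le ω ht) (Real.exp_pos _).le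

/-- Differentiating in `ω` reduces this to `integral_exp_neg_mul_cos`. -/
theorem integral_exp_neg_mul_sin_div (ω : ℝ) :
    ∫ t in Set.Ioi (0 : ℝ), Real.exp (-t) * (Real.sin (ω * t) / t) = Real.arctan ω := by
  set F : ℝ → ℝ := fun w => ∫ t in Set.Ioi (0 : ℝ), Real.exp (-t) * (Real.sin (w * t) / t)
  have hF : ∀ w, HasDerivAt F (1 / (1 + w ^ 2)) w := by
    intro w
    rw [← integral_exp_neg_mul_cos w]
    refine (hasDerivAt_integral_of_dominated_loc_of_deriv_le
      (μ := volume.restrict (Set.Ioi 0))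
      (F := fun w t => Real.exp (-t) * (Real.sin (w * t) / t))
      (F' := fun w t => Real.exp (-t) * Real.cos (w * t)) (bound := fun t => Real.exp (-t))
      (s := Set.univ) univ_mem ?_ (integrableOn_exp_neg_mul_sin_div w) ?_ ?_
      (integrableOn_exp_neg_Ioi 0) ?_).2
    · exact Eventually.of_forall fun w => (integrableOn_exp_neg_mul_sin_div w).aestronglyMeasurable
    · exact Measurable.aestronglyMeasurable (by fun_prop)
    · filter_upwards with t w _
      rw [norm_mul, Real.norm_eq_abs, Real.norm_eq_abs, Real.abs_exp]
      exact mul_le_of_le_one_right (Real.exp_pos _).le (Real.abs_cos_le_one _)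
    · filter_upwards [ae_restrict_mem measurableSet_Ioi] with t ht w _
      have ht : t ≠ 0 := (Set.mem_Ioi.1 ht).ne'
      have h := (((hasDerivAt_id w).mul_const t).sin.div_const t).const_mul (Real.exp (-t))
      refine h.congr_deriv ?_
      rw [id_eq, one_mul, mul_div_cancel_right₀ _ ht]
  have hG : ∀ w, HasDerivAt (fun w => F w - Real.arctan w) 0 w := by
    intro w
    have h := (hF w).sub (Real.hasDerivAt_arctan w)
    rwa [sub_self] at h
  have hc := is_const_of_deriv_eq_zero (fun w => (hG w).differentiableAt)
    (fun w => (hG w).deriv) ω 0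
  have h0 : F 0 = 0 := by simp [F]
  simp only [h0, Real.arctan_zero, sub_self] at hc
  linarith

theorem tendsto_arctan_mul_sign {ω : ℝ} (hω : ω ≠ 0) :
    Tendsto (fun R : ℝ => Real.arctan (R * ω)) atTop (𝓝 (SignType.sign ω * (Real.pi / 2))) := by
  rcases lt_or_gt_of_ne hω with h | h
  · simp only [sign_neg h, SignType.coe_neg_one, neg_mul, one_mul]
    exact (tendsto_nhds_of_tendsto_nhdsWithin Real.tendsto_arctan_atBot).comp
      (tendsto_id.atTop_mul_const_of_neg h)
  · simp only [sign_pos h, SignType.coe_one, one_mul]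
    exact (tendsto_nhds_of_tendsto_nhdsWithin Real.tendsto_arctan_atTop).comp
      (tendsto_id.atTop_mul_const h)

/-! ### The directional Hilbert transform of a compactly supported function -/

section Hilbert

open scoped RealInnerProductSpace ContDiff

variable {E : Type*} [NormedAddCommGroup E] [InnerProductSpace ℝ E]

/-- The directional Hilbert transform on real functions, as the integral
`(1/π) ∫_0^∞ (f (x - t v) - f (x + t v)) dt / t`. For Lipschitz functions of compact support this
converges absolutely, and it is the principal value `(1/π) p.v. ∫ f (x - t v) dt / t`. -/
noncomputable def lineHilbert (v : E) (f : E → ℝ) (x : E) : ℝ :=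
  (1 / Real.pi) * ∫ t in Set.Ioi (0 : ℝ), (f (x - t • v) - f (x + t • v)) / t

theorem apply_line_eq_zero {v x : E} (hv : ‖v‖ = 1) {f : E → ℝ} {ρ : ℝ}
    (hf : ∀ y, ρ ≤ ‖y‖ → f y = 0) {σ : ℝ} (hx : ‖x‖ ≤ σ) {t : ℝ} (ht : σ + ρ ≤ |t|) :
    f (x + t • v) = 0 := by
  refine hf _ ?_
  have h1 : ‖t • v‖ = |t| := by rw [norm_smul, hv, mul_one, Real.norm_eq_abs]
  have h2 : ‖t • v‖ ≤ ‖x + t • v‖ + ‖x‖ := by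
    simpa using norm_sub_le (x + t • v) x
  linarith

theorem apply_line_sub_eq_zero {v x : E} (hv : ‖v‖ = 1) {f : E → ℝ} {ρ : ℝ}
    (hf : ∀ y, ρ ≤ ‖y‖ → f y = 0) {σ : ℝ} (hx : ‖x‖ ≤ σ) {t : ℝ} (ht : σ + ρ ≤ |t|) :
    f (x - t • v) = 0 := by
  have := apply_line_eq_zero hv hf hx (t := -t) (by rwa [abs_neg])
  rwa [neg_smul, ← sub_eq_add_neg] at this

theorem LipschitzWith.abs_apply_add_sub_le {v : E} (hv : ‖v‖ = 1) {f : E → ℝ} {L : NNReal}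
    (hL : LipschitzWith L f) (x : E) (s t : ℝ) : |f (x + s • v) - f (x + t • v)| ≤ L * |s - t| := by
  have := hL.dist_le_mul (x + s • v) (x + t • v)
  rwa [Real.dist_eq, dist_add_left, dist_eq_norm, ← sub_smul, norm_smul, hv, mul_one,
    Real.norm_eq_abs] at this

theorem abs_lineHilbert_integrand_le {v x : E} (hv : ‖v‖ = 1) {f : E → ℝ} {ρ : ℝ}
    (hf : ∀ y, ρ ≤ ‖y‖ → f y = 0) {L : NNReal} (hL : LipschitzWith L f) {σ : ℝ} (hx : ‖x‖ ≤ σ)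
    {t : ℝ} (ht : 0 < t) :
    |(f (x - t • v) - f (x + t • v)) / t|
      ≤ (Set.Ioc 0 (σ + ρ)).indicator (fun _ => 2 * (L : ℝ)) t := by
  by_cases h : t ≤ σ + ρ
  · rw [Set.indicator_of_mem (Set.mem_Ioc.2 ⟨ht, h⟩), abs_div, abs_of_pos ht, div_le_iff₀ ht]
    have := hL.abs_apply_add_sub_le hv x (-t) t
    rw [neg_smul, ← sub_eq_add_neg] at this
    refine this.trans (le_of_eq ?_)
    rw [show -t - t = -(2 * t) by ring, abs_neg, abs_of_pos (by positivity)]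
    ring
  · have h' : σ + ρ ≤ |t| := (not_le.1 h).le.trans (le_abs_self t)
    rw [apply_line_eq_zero hv hf hx h', apply_line_sub_eq_zero hv hf hx h']
    simp [h]

theorem integrable_indicator_Ioc_const (a c : ℝ) :
    IntegrableOn ((Set.Ioc 0 a).indicator (fun _ => c)) (Set.Ioi (0 : ℝ)) :=
  ((integrable_indicator_iff measurableSet_Ioc).2
    (integrableOn_const (by simp) (by simp))).integrableOn

theorem integrableOn_lineHilbert_integrand {v : E} (hv : ‖v‖ = 1) {f : E → ℝ} {ρ : ℝ}
    (hf : ∀ y, ρ ≤ ‖y‖ → f y = 0) {L : NNReal} (hL : LipschitzWith L f) (x : E) :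
    IntegrableOn (fun t : ℝ => (f (x - t • v) - f (x + t • v)) / t) (Set.Ioi 0) := by
  have hc := hL.continuous
  refine Integrable.mono' (integrable_indicator_Ioc_const (‖x‖ + ρ) (2 * (L : ℝ)))
    (Measurable.aestronglyMeasurable (Measurable.div (Continuous.measurable (by fun_prop))
      measurable_id)) ?_
  filter_upwards [ae_restrict_mem measurableSet_Ioi] with t ht
  exact abs_lineHilbert_integrand_le hv hf hL le_rfl ht

theorem lineHilbert_add {v : E} (hv : ‖v‖ = 1) {f g : E → ℝ} {ρ : ℝ}
    (hf : ∀ y, ρ ≤ ‖y‖ → f y = 0) {L : NNReal} (hL : LipschitzWith L f)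
    (hg : ∀ y, ρ ≤ ‖y‖ → g y = 0) {K : NNReal} (hK : LipschitzWith K g) (x : E) :
    lineHilbert v (f + g) x = lineHilbert v f x + lineHilbert v g x := by
  unfold lineHilbert
  rw [← mul_add, ← integral_add (integrableOn_lineHilbert_integrand hv hf hL x)
    (integrableOn_lineHilbert_integrand hv hg hK x)]
  congr 2 with t
  simp only [Pi.add_apply]
  ring

theorem lineHilbert_zero (v x : E) : lineHilbert v 0 x = 0 := by simp [lineHilbert]

theorem abs_lineHilbert_le {v : E} (hv : ‖v‖ = 1) {f : E → ℝ} {ρ : ℝ} (hρ : 0 ≤ ρ)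
    (hf : ∀ y, ρ ≤ ‖y‖ → f y = 0) {L : NNReal} (hL : LipschitzWith L f) {x : E} (hx : ‖x‖ ≤ ρ) :
    |lineHilbert v f x| ≤ (1 / Real.pi) * ((ρ + ρ) * (2 * L)) := by
  unfold lineHilbert
  rw [abs_mul, abs_of_pos (by positivity : 0 < 1 / Real.pi)]
  refine mul_le_mul_of_nonneg_left ?_ (by positivity)
  rw [← Real.norm_eq_abs]
  refine (norm_integral_le_of_norm_le (integrable_indicator_Ioc_const (ρ + ρ) (2 * (L : ℝ)))
    ?_).trans (le_of_eq ?_)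
  · filter_upwards [ae_restrict_mem measurableSet_Ioi] with t ht
    exact abs_lineHilbert_integrand_le hv hf hL hx ht
  · rw [integral_indicator measurableSet_Ioc, Measure.restrict_restrict measurableSet_Ioc,
      Set.inter_eq_left.2 Set.Ioc_subset_Ioi_self, setIntegral_const]
    simp [Measure.real, hρ]

theorem measurable_lineHilbert [MeasurableSpace E] [BorelSpace E] [SecondCountableTopology E]
    (v : E) {f : E → ℝ} (hf : Continuous f) : Measurable (lineHilbert v f) := by
  unfold lineHilbert
  refine Measurable.const_mul ?_ _
  refine (StronglyMeasurable.integral_prod_right' (ν := volume.restrict (Set.Ioi (0 : ℝ)))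
    (f := fun z : E × ℝ => (f (z.1 - z.2 • v) - f (z.1 + z.2 • v)) / z.2) ?_).measurable
  refine Measurable.stronglyMeasurable (Measurable.div (Continuous.measurable (by fun_prop))
      measurable_snd)

end Hilbert

theorem tendsto_setIntegral_Ioi_zero {φ : ℝ → ℂ} (hφ : IntegrableOn φ (Set.Ioi 0)) :
    Tendsto (fun ε : ℝ => ∫ t in Set.Ioi ε, φ t) (𝓝[>] 0) (𝓝 (∫ t in Set.Ioi 0, φ t)) := by
  have h : ∀ ε : ℝ, 0 < ε →
      ∫ t in Set.Ioi 0, (Set.Ioi ε).indicator φ t = ∫ t in Set.Ioi ε, φ t := fun ε hε => by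
    rw [integral_indicator measurableSet_Ioi, Measure.restrict_restrict measurableSet_Ioi,
      Set.inter_eq_left.2 (Set.Ioi_subset_Ioi hε.le)]
  refine Tendsto.congr' (f₁ := fun ε : ℝ => ∫ t in Set.Ioi 0, (Set.Ioi ε).indicator φ t) ?_ ?_
  · filter_upwards [self_mem_nhdsWithin] with ε hε using h ε hε
  refine tendsto_integral_filter_of_dominated_convergence (fun t => ‖φ t‖) ?_ ?_ hφ.norm ?_
  · exact Eventually.of_forall fun ε => hφ.aestronglyMeasurable.indicator measurableSet_Ioi
  · exact Eventually.of_forall fun ε => Eventually.of_forall fun t => norm_indicator_le_norm_self _ _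
  · filter_upwards [ae_restrict_mem measurableSet_Ioi] with t ht
    refine tendsto_const_nhds.congr' ?_
    filter_upwards [Ioo_mem_nhdsGT (Set.mem_Ioi.1 ht)] with ε hε
    rw [Set.indicator_of_mem (Set.mem_Ioi.2 hε.2)]

/-- The two half-lines of `|t| > ε` are folded together by `t ↦ -t`. -/
theorem integral_abs_gt_div {g : ℝ → ℂ} (hg : Continuous g) (hgc : HasCompactSupport g) {ε : ℝ}
    (hε : 0 < ε) :
    ∫ t in {t : ℝ | ε < |t|}, g t / (t : ℂ) = ∫ t in Set.Ioi ε, (g t - g (-t)) / (t : ℂ) := by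
  have hset : {t : ℝ | ε < |t|} = Set.Ioi ε ∪ Set.Iio (-ε) := by
    ext t; simp only [Set.mem_ofPred_eq, lt_abs, Set.mem_union, Set.mem_Ioi, Set.mem_Iio, lt_neg]
  have hint : IntegrableOn (fun t : ℝ => g t / (t : ℂ)) {t : ℝ | ε < |t|} := by
    refine Integrable.mono' (g := fun t => ‖g t‖ / ε)
      ((hg.integrable_of_hasCompactSupport hgc).norm.div_const ε).integrableOn
      (Measurable.aestronglyMeasurable (hg.measurable.div Complex.measurable_ofReal)) ?_
    filter_upwards [ae_restrict_mem (measurableSet_lt measurable_const measurable_id.abs)] with t ht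
    rw [norm_div, Complex.norm_real, Real.norm_eq_abs]
    exact div_le_div_of_nonneg_left (norm_nonneg _) hε (le_of_lt ht)
  have h1 : IntegrableOn (fun t : ℝ => g t / (t : ℂ)) (Set.Ioi ε) :=
    hint.mono_set (by rw [hset]; exact Set.subset_union_left)
  have h2 : IntegrableOn (fun t : ℝ => g t / (t : ℂ)) (Set.Iio (-ε)) :=
    hint.mono_set (by rw [hset]; exact Set.subset_union_right)
  have h3 : ∫ t in Set.Iio (-ε), g t / (t : ℂ) = ∫ t in Set.Ioi ε, g (-t) / ((-t : ℝ) : ℂ) := by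
    rw [integral_comp_neg_Ioi (f := fun t : ℝ => g t / (t : ℂ)), integral_Iic_eq_integral_Iio]
  have h2' : IntegrableOn (fun t : ℝ => g (-t) / ((-t : ℝ) : ℂ)) (Set.Ioi ε) := by
    have := ((integrableOn_Iic_iff_integrableOn_Iio (by simp)).2 h2).comp_neg_Ici
    exact (integrableOn_Ici_iff_integrableOn_Ioi (by simp)).1 this
  rw [hset, setIntegral_union ?_ measurableSet_Iio h1 h2, h3, ← integral_add h1 h2']
  · congr 1 with t
    push_cast
    rw [div_neg, sub_div, sub_eq_add_neg]
  · refine Set.disjoint_left.2 fun t ht ht' => ?_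
    simp only [Set.mem_Ioi, Set.mem_Iio] at ht ht'
    linarith

theorem directionalHilbert_eq_lineHilbert {n : ℕ} {v : EuclideanSpace ℝ (Fin n)} (hv : ‖v‖ = 1)
    {f : EuclideanSpace ℝ (Fin n) → ℝ} {ρ : ℝ} (hf : ∀ y, ρ ≤ ‖y‖ → f y = 0) {L : NNReal}
    (hL : LipschitzWith L f) (F : 𝓢(EuclideanSpace ℝ (Fin n), ℂ)) (hF : ∀ y, F y = (f y : ℂ))
    (x : EuclideanSpace ℝ (Fin n)) :
    directionalHilbert v F x = (lineHilbert v f x : ℂ) := by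
  unfold directionalHilbert lineHilbert
  have hc := hL.continuous
  have hg : Continuous fun t : ℝ => F (x - t • v) := by fun_prop
  have hgc : HasCompactSupport fun t : ℝ => F (x - t • v) := by
    refine HasCompactSupport.of_support_subset_isCompact
      (isCompact_closedBall (0 : ℝ) (‖x‖ + ρ)) fun t ht => ?_
    by_contra h
    rw [Metric.mem_closedBall, dist_zero_right, not_le, Real.norm_eq_abs] at h
    exact ht (by
      change F (x - t • v) = 0
      rw [hF, apply_line_sub_eq_zero hv hf le_rfl h.le, Complex.ofReal_zero])
  have hi := (integrableOn_lineHilbert_integrand hv hf hL x).ofReal (𝕜 := ℂ)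
  have ht := tendsto_setIntegral_Ioi_zero hi
  have key : Tendsto (fun ε : ℝ => ∫ t in {t : ℝ | ε < |t|}, F (x - t • v) / (t : ℂ)) (𝓝[>] 0)
      (𝓝 (∫ t in Set.Ioi (0 : ℝ), (((f (x - t • v) - f (x + t • v)) / t : ℝ) : ℂ))) := by
    refine ht.congr' ?_
    filter_upwards [self_mem_nhdsWithin] with ε hε
    rw [integral_abs_gt_div hg hgc hε]
    congr 1 with t
    simp [hF]
  rw [key.limUnder_eq, integral_complex_ofReal]
  push_cast
  rfl

/-! ### Modulated functions at high frequency -/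

section Modulated

open scoped RealInnerProductSpace

variable {E : Type*} [NormedAddCommGroup E] [InnerProductSpace ℝ E]

/-- The kernel left over when `∫_0^∞ (g (x - t v) + g (x + t v)) sin (w t) dt / t` is compared with
`2 g(x) ∫_0^∞ e^{-t} sin (w t) dt / t`; the subtraction removes the singularity at `t = 0`. -/
noncomputable def evenKernel (v : E) (g : E → ℝ) (x : E) (t : ℝ) : ℝ :=
  (g (x - t • v) + g (x + t • v) - 2 * g x * Real.exp (-t)) / t

theorem abs_evenKernel_le {v x : E} (hv : ‖v‖ = 1) {g : E → ℝ} {ρ : ℝ} (hρ : 0 ≤ ρ)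
    (hg : ∀ y, ρ ≤ ‖y‖ → g y = 0) {L : NNReal} (hL : LipschitzWith L g) {M : ℝ}
    (hM : ∀ y, |g y| ≤ M) (hx : ‖x‖ ≤ ρ) {t : ℝ} (ht : 0 < t) :
    |evenKernel v g x t| ≤ (Set.Ioc 0 (ρ + ρ + 1)).indicator (fun _ => 2 * (L : ℝ) + 2 * M) t
      + 2 * M * Real.exp (-t) := by
  have hM0 : 0 ≤ M := (abs_nonneg _).trans (hM x)
  unfold evenKernel
  rw [abs_div, abs_of_pos ht, div_le_iff₀ ht]
  by_cases h : t ≤ ρ + ρ + 1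
  · rw [Set.indicator_of_mem (Set.mem_Ioc.2 ⟨ht, h⟩)]
    have h1 := hL.abs_apply_add_sub_le hv x (-t) 0
    have h2 := hL.abs_apply_add_sub_le hv x t 0
    rw [neg_smul, ← sub_eq_add_neg, zero_smul, add_zero, sub_zero, abs_neg, abs_of_pos ht] at h1
    rw [zero_smul, add_zero, sub_zero, abs_of_pos ht] at h2
    have h3 : |g x * (1 - Real.exp (-t))| ≤ M * t := by
      rw [abs_mul]
      have h4 : Real.exp (-t) ≤ 1 := Real.exp_le_one_iff.2 (by linarith)
      have h5 := Real.add_one_le_exp (-t)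
      refine mul_le_mul (hM x) ?_ (abs_nonneg _) hM0
      rw [abs_of_nonneg (by linarith)]
      linarith
    have h6 : 0 ≤ 2 * M * Real.exp (-t) * t := by positivity
    have e : g (x - t • v) + g (x + t • v) - 2 * g x * Real.exp (-t)
        = (g (x - t • v) - g x) + (g (x + t • v) - g x) + 2 * (g x * (1 - Real.exp (-t))) := by ring
    rw [e]
    rw [abs_le] at *
    constructor <;> nlinarith
  · have h' : ρ + ρ ≤ |t| := by
      have := le_abs_self t
      linarith
    have ht1 : 1 ≤ t := by linarith
    rw [apply_line_eq_zero hv hg hx h', apply_line_sub_eq_zero hv hg hx h',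
      Set.indicator_of_notMem (by simp [h])]
    simp only [zero_add, zero_sub, abs_neg, abs_mul, Real.abs_exp, abs_two]
    have := hM x
    have he := Real.exp_pos (-t)
    calc 2 * |g x| * Real.exp (-t) ≤ 2 * M * Real.exp (-t) := by gcongr
      _ ≤ 2 * M * Real.exp (-t) * t := le_mul_of_one_le_right (by positivity) ht1

theorem integrableOn_evenKernel_bound (a c M : ℝ) :
    IntegrableOn (fun t => (Set.Ioc 0 a).indicator (fun _ => c) t + 2 * M * Real.exp (-t))
      (Set.Ioi (0 : ℝ)) :=
  (integrable_indicator_Ioc_const a c).add ((integrableOn_exp_neg_Ioi 0).const_mul _)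

theorem integrableOn_evenKernel {v x : E} (hv : ‖v‖ = 1) {g : E → ℝ} {ρ : ℝ} (hρ : 0 ≤ ρ)
    (hg : ∀ y, ρ ≤ ‖y‖ → g y = 0) {L : NNReal} (hL : LipschitzWith L g) {M : ℝ}
    (hM : ∀ y, |g y| ≤ M) (hx : ‖x‖ ≤ ρ) : IntegrableOn (evenKernel v g x) (Set.Ioi 0) := by
  have hc := hL.continuous
  refine Integrable.mono' (integrableOn_evenKernel_bound (ρ + ρ + 1) (2 * L + 2 * M) M)
    (Measurable.aestronglyMeasurable (Measurable.div (Continuous.measurable (by fun_prop))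
      measurable_id)) ?_
  filter_upwards [ae_restrict_mem measurableSet_Ioi] with t ht
  exact abs_evenKernel_le hv hρ hg hL hM hx ht

theorem MeasureTheory.IntegrableOn.mul_cos {f : ℝ → ℝ} {s : Set ℝ} (hf : IntegrableOn f s) (w : ℝ) :
    IntegrableOn (fun t => f t * Real.cos (w * t)) s :=
  Integrable.mul_bdd (c := 1) hf (Continuous.aestronglyMeasurable (by fun_prop))
    (Eventually.of_forall fun t => Real.abs_cos_le_one _)

theorem MeasureTheory.IntegrableOn.mul_sin {f : ℝ → ℝ} {s : Set ℝ} (hf : IntegrableOn f s) (w : ℝ) :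
    IntegrableOn (fun t => f t * Real.sin (w * t)) s :=
  Integrable.mul_bdd (c := 1) hf (Continuous.aestronglyMeasurable (by fun_prop))
    (Eventually.of_forall fun t => Real.abs_sin_le_one _)

/-- The addition formula for the cosine splits the transform of a modulated function into two
oscillatory integrals with integrable amplitudes and a main term. -/
theorem lineHilbert_mul_cos {v x : E} (hv : ‖v‖ = 1) {g : E → ℝ} {ρ : ℝ} (hρ : 0 ≤ ρ)
    (hg : ∀ y, ρ ≤ ‖y‖ → g y = 0) {L : NNReal} (hL : LipschitzWith L g) {M : ℝ}
    (hM : ∀ y, |g y| ≤ M) (hx : ‖x‖ ≤ ρ) (μ : E) (R : ℝ) :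
    lineHilbert v (fun y => g y * Real.cos (R * ⟪μ, y⟫)) x = (1 / Real.pi) *
      (Real.cos (R * ⟪μ, x⟫) * (∫ t in Set.Ioi (0 : ℝ),
          (g (x - t • v) - g (x + t • v)) / t * Real.cos (R * ⟪μ, v⟫ * t)) +
        Real.sin (R * ⟪μ, x⟫) * (∫ t in Set.Ioi (0 : ℝ),
          evenKernel v g x t * Real.sin (R * ⟪μ, v⟫ * t)) +
        2 * (g x * Real.sin (R * ⟪μ, x⟫)) * Real.arctan (R * ⟪μ, v⟫)) := by
  have hA := (IntegrableOn.mul_cos (integrableOn_lineHilbert_integrand hv hg hL x)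
    (R * ⟪μ, v⟫)).const_mul (Real.cos (R * ⟪μ, x⟫))
  have hB := (IntegrableOn.mul_sin (integrableOn_evenKernel hv hρ hg hL hM hx)
    (R * ⟪μ, v⟫)).const_mul (Real.sin (R * ⟪μ, x⟫))
  have hC := (integrableOn_exp_neg_mul_sin_div (R * ⟪μ, v⟫)).const_mul
    (2 * (g x * Real.sin (R * ⟪μ, x⟫)))
  unfold lineHilbert
  congr 1
  rw [← integral_exp_neg_mul_sin_div, ← integral_const_mul, ← integral_const_mul,
    ← integral_const_mul, ← integral_add hA hB]
  refine Eq.trans ?_ (integral_add (hA.add hB) hC)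
  congr 1 with t
  simp only [inner_sub_right, inner_add_right, real_inner_smul_right, mul_sub, mul_add, evenKernel]
  rw [Real.cos_sub, Real.cos_add, show R * (t * ⟪μ, v⟫) = R * ⟪μ, v⟫ * t by ring]
  ring

/-- At high frequency `R`, the transform in direction `v` turns `g cos (R ⟪μ, ·⟫)` into
`± g sin (R ⟪μ, ·⟫)`, the sign being that of `⟪μ, v⟫`. -/
theorem tendsto_integral_abs_lineHilbert_sub [FiniteDimensional ℝ E] [MeasurableSpace E]
    [BorelSpace E] {v : E} (hv : ‖v‖ = 1) {g : E → ℝ} {ρ : ℝ} (hρ : 0 ≤ ρ)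
    (hg : ∀ y, ρ ≤ ‖y‖ → g y = 0) {L : NNReal} (hL : LipschitzWith L g) {M : ℝ}
    (hM : ∀ y, |g y| ≤ M) {μ : E} (hμ : ⟪μ, v⟫ ≠ 0) :
    Tendsto (fun R : ℝ => ∫ x in Metric.ball (0 : E) ρ,
      |lineHilbert v (fun y => g y * Real.cos (R * ⟪μ, y⟫)) x
        - SignType.sign ⟪μ, v⟫ * (g x * Real.sin (R * ⟪μ, x⟫))|) atTop (𝓝 0) := by
  have hc := hL.continuous
  have hM0 : 0 ≤ M := (abs_nonneg _).trans (hM 0)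
  set A : E → ℝ → ℝ := fun x R => ∫ t in Set.Ioi (0 : ℝ),
    (g (x - t • v) - g (x + t • v)) / t * Real.cos (R * ⟪μ, v⟫ * t) with hA
  set B : E → ℝ → ℝ := fun x R => ∫ t in Set.Ioi (0 : ℝ),
    evenKernel v g x t * Real.sin (R * ⟪μ, v⟫ * t) with hB
  set D : ℝ → ℝ := fun R => Real.arctan (R * ⟪μ, v⟫) - SignType.sign ⟪μ, v⟫ * (Real.pi / 2) with hD
  have hbound : ∀ x R, ‖x‖ ≤ ρ → |lineHilbert v (fun y => g y * Real.cos (R * ⟪μ, y⟫)) x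
        - SignType.sign ⟪μ, v⟫ * (g x * Real.sin (R * ⟪μ, x⟫))|
      ≤ (1 / Real.pi) * (|A x R| + |B x R| + 2 * M * |D R|) := by
    intro x R hx
    rw [lineHilbert_mul_cos hv hρ hg hL hM hx μ R]
    have e : (1 / Real.pi) * (Real.cos (R * ⟪μ, x⟫) * A x R + Real.sin (R * ⟪μ, x⟫) * B x R +
          2 * (g x * Real.sin (R * ⟪μ, x⟫)) * Real.arctan (R * ⟪μ, v⟫))
        - SignType.sign ⟪μ, v⟫ * (g x * Real.sin (R * ⟪μ, x⟫))
        = (1 / Real.pi) * (Real.cos (R * ⟪μ, x⟫) * A x R + Real.sin (R * ⟪μ, x⟫) * B x R +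
          2 * (g x * Real.sin (R * ⟪μ, x⟫)) * D R) := by
      simp only [hD]
      field_simp
      ring
    rw [e, abs_mul, abs_of_pos (by positivity : 0 < 1 / Real.pi)]
    refine mul_le_mul_of_nonneg_left ((abs_add_three _ _ _).trans ?_) (by positivity)
    simp only [abs_mul, abs_two]
    have hcos := Real.abs_cos_le_one (R * ⟪μ, x⟫)
    have hsin := Real.abs_sin_le_one (R * ⟪μ, x⟫)
    refine add_le_add_three (mul_le_of_le_one_left (abs_nonneg _) hcos)
      (mul_le_of_le_one_left (abs_nonneg _) hsin)
      (mul_le_mul_of_nonneg_right (mul_le_mul_of_nonneg_left ?_ two_pos.le) (abs_nonneg _))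
    exact (mul_le_of_le_one_right (abs_nonneg _) hsin).trans (hM x)
  have hmeas : ∀ R, Measurable fun x => |lineHilbert v (fun y => g y * Real.cos (R * ⟪μ, y⟫)) x
        - SignType.sign ⟪μ, v⟫ * (g x * Real.sin (R * ⟪μ, x⟫))| := fun R =>
    ((measurable_lineHilbert v (by fun_prop)).sub (Continuous.measurable (by fun_prop))).abs
  have hDlim : Tendsto D atTop (𝓝 0) := by
    have := (tendsto_arctan_mul_sign hμ).sub_const (SignType.sign ⟪μ, v⟫ * (Real.pi / 2))
    rwa [sub_self] at this
  have hball : ∀ x ∈ Metric.ball (0 : E) ρ, ‖x‖ ≤ ρ := fun x hx => (mem_ball_zero_iff.1 hx).le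
  set KA : ℝ := ∫ t in Set.Ioi (0 : ℝ), (Set.Ioc 0 (ρ + ρ)).indicator (fun _ => 2 * (L : ℝ)) t
  set KB : ℝ := ∫ t in Set.Ioi (0 : ℝ), ((Set.Ioc 0 (ρ + ρ + 1)).indicator
    (fun _ => 2 * (L : ℝ) + 2 * M) t + 2 * M * Real.exp (-t))
  have hAle : ∀ x R, ‖x‖ ≤ ρ → |A x R| ≤ KA := by
    intro x R hx
    rw [← Real.norm_eq_abs]
    refine norm_integral_le_of_norm_le (integrable_indicator_Ioc_const (ρ + ρ) (2 * (L : ℝ))) ?_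
    filter_upwards [ae_restrict_mem measurableSet_Ioi] with t ht
    rw [norm_mul]
    exact (mul_le_of_le_one_right (norm_nonneg _) (Real.abs_cos_le_one _)).trans
      (abs_lineHilbert_integrand_le hv hg hL hx ht)
  have hBle : ∀ x R, ‖x‖ ≤ ρ → |B x R| ≤ KB := by
    intro x R hx
    rw [← Real.norm_eq_abs]
    refine norm_integral_le_of_norm_le
      (integrableOn_evenKernel_bound (ρ + ρ + 1) (2 * L + 2 * M) M) ?_
    filter_upwards [ae_restrict_mem measurableSet_Ioi] with t ht
    rw [norm_mul]
    exact (mul_le_of_le_one_right (norm_nonneg _) (Real.abs_sin_le_one _)).trans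
      (abs_evenKernel_le hv hρ hg hL hM hx ht)
  have hlim : ∀ x ∈ Metric.ball (0 : E) ρ,
      Tendsto (fun R => (1 / Real.pi) * (|A x R| + |B x R| + 2 * M * |D R|)) atTop (𝓝 0) := by
    intro x hx
    have h1 := tendsto_integral_Ioi_mul_cos (integrableOn_lineHilbert_integrand hv hg hL x) hμ
    have h2 := tendsto_integral_Ioi_mul_sin
      (integrableOn_evenKernel hv hρ hg hL hM (hball x hx)) hμ
    have := ((h1.abs.add h2.abs).add (hDlim.abs.const_mul (2 * M))).const_mul (1 / Real.pi)
    simpa using this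
  have hDle : ∀ᶠ R in atTop, |D R| ≤ 1 := by
    have := hDlim.abs
    rw [abs_zero] at this
    exact (this.eventually_lt_const one_pos).mono fun R h => h.le
  have key := tendsto_integral_filter_of_dominated_convergence
    (μ := volume.restrict (Metric.ball (0 : E) ρ)) (l := (atTop : Filter ℝ))
    (F := fun R x => |lineHilbert v (fun y => g y * Real.cos (R * ⟪μ, y⟫)) x
        - SignType.sign ⟪μ, v⟫ * (g x * Real.sin (R * ⟪μ, x⟫))|) (f := fun _ => (0 : ℝ))
    (fun _ => (1 / Real.pi) * (KA + KB + 2 * M)) ?_ ?_ ?_ ?_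
  · simpa using key
  · exact Eventually.of_forall fun R => (hmeas R).aestronglyMeasurable
  · filter_upwards [hDle] with R hR
    filter_upwards [ae_restrict_mem Metric.isOpen_ball.measurableSet] with x hx
    rw [Real.norm_eq_abs, abs_abs]
    refine (hbound x R (hball x hx)).trans (mul_le_mul_of_nonneg_left ?_ (by positivity))
    refine add_le_add_three (hAle x R (hball x hx)) (hBle x R (hball x hx)) ?_
    exact mul_le_of_le_one_right (by positivity) hR
  · exact integrableOn_const (by finiteness)
  · filter_upwards [ae_restrict_mem Metric.isOpen_ball.measurableSet] with x hx
    exact squeeze_zero (fun R => abs_nonneg _) (fun R => hbound x R (hball x hx)) (hlim x hx)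

end Modulated

/-! ### Smooth functions supported in a bounded set -/

section Support

open scoped RealInnerProductSpace ContDiff

variable {E : Type*} [NormedAddCommGroup E]

theorem apply_eq_zero_of_le_norm {O : Set E} {ρ : ℝ} (hO : O ⊆ Metric.ball 0 ρ) {f : E → ℝ}
    (hf : ∀ x ∉ O, f x = 0) {y : E} (hy : ρ ≤ ‖y‖) : f y = 0 :=
  hf y fun h => not_lt.2 hy (mem_ball_zero_iff.1 (hO h))

variable [InnerProductSpace ℝ E] [FiniteDimensional ℝ E]

theorem hasCompactSupport_of_subset_ball {O : Set E} {ρ : ℝ} (hO : O ⊆ Metric.ball 0 ρ)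
    {f : E → ℝ} (hf : ∀ x ∉ O, f x = 0) : HasCompactSupport f :=
  HasCompactSupport.of_support_subset_isCompact (isCompact_closedBall (0 : E) ρ) fun x hx =>
    Metric.ball_subset_closedBall (hO (by_contra fun h => hx (hf x h)))

theorem exists_lipschitzWith_of_subset_ball {O : Set E} {ρ : ℝ} (hO : O ⊆ Metric.ball 0 ρ)
    {f : E → ℝ} (hf : ∀ x ∉ O, f x = 0) (hs : ContDiff ℝ ∞ f) : ∃ L, LipschitzWith L f :=
  hs.lipschitzWith_of_hasCompactSupport (hasCompactSupport_of_subset_ball hO hf) (by simp)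

theorem lineHilbert_add_of_subset_ball {O : Set E} {ρ : ℝ} (hO : O ⊆ Metric.ball 0 ρ)
    {f g : E → ℝ} (hf : ∀ x ∉ O, f x = 0) (hfs : ContDiff ℝ ∞ f) (hg : ∀ x ∉ O, g x = 0)
    (hgs : ContDiff ℝ ∞ g) {v : E} (hv : ‖v‖ = 1) (x : E) :
    lineHilbert v (f + g) x = lineHilbert v f x + lineHilbert v g x := by
  obtain ⟨L, hL⟩ := exists_lipschitzWith_of_subset_ball hO hf hfs
  obtain ⟨K, hK⟩ := exists_lipschitzWith_of_subset_ball hO hg hgs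
  exact lineHilbert_add hv (fun y hy => apply_eq_zero_of_le_norm hO hf hy) hL
    (fun y hy => apply_eq_zero_of_le_norm hO hg hy) hK x

variable [MeasurableSpace E] [BorelSpace E]

theorem integrableOn_lineHilbert {O : Set E} {ρ : ℝ} (hρ : 0 ≤ ρ) (hO : O ⊆ Metric.ball 0 ρ)
    {f : E → ℝ} (hf : ∀ x ∉ O, f x = 0) (hs : ContDiff ℝ ∞ f) {v : E} (hv : ‖v‖ = 1) :
    IntegrableOn (lineHilbert v f) (Metric.ball 0 ρ) := by
  obtain ⟨L, hL⟩ := exists_lipschitzWith_of_subset_ball hO hf hs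
  refine Integrable.mono' (integrableOn_const (C := (1 / Real.pi) * ((ρ + ρ) * (2 * L)))
    (by finiteness)) (measurable_lineHilbert v hL.continuous).aestronglyMeasurable ?_
  filter_upwards [ae_restrict_mem Metric.isOpen_ball.measurableSet] with x hx
  exact abs_lineHilbert_le hv hρ (fun y hy => apply_eq_zero_of_le_norm hO hf hy) hL
    (mem_ball_zero_iff.1 hx).le

/-- The indicator function of an open set of finite measure is approximated from below by smooth
functions. -/
theorem exists_contDiff_integral_ge {O : Set E} (hO : IsOpen O) (hfin : volume O ≠ ⊤) {η : ℝ}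
    (hη : 0 < η) :
    ∃ g : E → ℝ, ContDiff ℝ ∞ g ∧ (∀ x ∉ O, g x = 0) ∧ (∀ x, 0 ≤ g x) ∧ (∀ x, g x ≤ 1) ∧
      volume.real O - η ≤ ∫ x in O, g x := by
  obtain ⟨K, hKO, hK, hKvol⟩ : ∃ K ⊆ O, IsCompact K ∧ volume.real O - η ≤ volume.real K := by
    by_cases h0 : volume O = 0
    · exact ⟨∅, Set.empty_subset _, isCompact_empty, by simp [Measure.real, h0, hη.le]⟩
    have hlt : volume O - ENNReal.ofReal η < volume O :=
      ENNReal.sub_lt_self hfin h0 (by simpa using hη)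
    obtain ⟨K, hKO, hK, hlt⟩ := hO.exists_lt_isCompact hlt
    refine ⟨K, hKO, hK, ?_⟩
    have h1 : volume O ≤ volume K + ENNReal.ofReal η := tsub_le_iff_right.1 hlt.le
    have hKt : volume K ≠ ⊤ := hK.measure_lt_top.ne
    have h2 := ENNReal.toReal_mono (by finiteness) h1
    rw [ENNReal.toReal_add hKt (by simp), ENNReal.toReal_ofReal hη.le] at h2
    simp only [Measure.real]
    linarith
  obtain ⟨g, hg, hrange, hsupp, hone⟩ := exists_contMDiff_support_eq_eq_one_iff (n := ⊤)
    (modelWithCornersSelf ℝ E) hO hK.isClosed hKO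
  have h0 : ∀ x, 0 ≤ g x := fun x => (hrange ⟨x, rfl⟩).1
  have h1 : ∀ x, g x ≤ 1 := fun x => (hrange ⟨x, rfl⟩).2
  have hgc : Continuous g := hg.continuous
  refine ⟨g, hg.contDiff, fun x hx => ?_, h0, h1, hKvol.trans ?_⟩
  · by_contra h
    exact hx (hsupp ▸ h)
  · have hint : IntegrableOn g O := by
      refine Integrable.mono' (integrableOn_const (C := (1 : ℝ)) hfin)
        hgc.aestronglyMeasurable (Eventually.of_forall fun x => ?_)
      rw [Real.norm_eq_abs, abs_of_nonneg (h0 x)]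
      exact h1 x
    calc volume.real K = ∫ x in K, (1 : ℝ) := by simp
      _ = ∫ x in K, g x := setIntegral_congr_fun hK.measurableSet fun x hx => ((hone x).1 hx).symm
      _ ≤ ∫ x in O, g x := setIntegral_mono_set hint (Eventually.of_forall h0)
          (Eventually.of_forall hKO)

theorem ae_sin_inner_ne_zero {μ : E} (hμ : μ ≠ 0) {R : ℝ} (hR : R ≠ 0) :
    ∀ᵐ x : E, Real.sin (R * ⟪μ, x⟫) ≠ 0 := by
  have hsurj : Function.Surjective (innerₛₗ ℝ μ : E →ₗ[ℝ] ℝ) := by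
    refine LinearMap.surjective fun h => hμ ?_
    have := LinearMap.congr_fun h μ
    simpa using this
  have hmeas : MeasurableSet {y : ℝ | Real.sin (R * y) ≠ 0} :=
    (isOpen_ne.preimage (by fun_prop : Continuous fun y : ℝ => Real.sin (R * y))).measurableSet
  refine (ae_comp_linearMap_mem_iff _ volume volume hsurj hmeas).2 ?_
  have hcount : {y : ℝ | Real.sin (R * y) = 0}.Countable := by
    refine (Set.countable_range fun n : ℤ => n * Real.pi / R).mono fun y hy => ?_
    obtain ⟨n, hn⟩ := Real.sin_eq_zero_iff.1 hy
    exact ⟨n, by simp only [hn]; field_simp⟩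
  filter_upwards [hcount.ae_notMem volume] with y hy using hy

end Support

/-- On one half `P` of a splitting, the term `Hc` contributes its main part `τ * w` and the term
`Ho`, coming from the other half, is an error; this holds for every selection of indices. -/
theorem exists_lower_selection {α : Type*} [MeasurableSpace α] {ν : Measure α} {P : Set α}
    {N : ℕ} {Hc Ho Hp : ℕ → α → ℝ} {w s : α → ℝ} {J : ℕ → Prop} (hJ : ∀ k, J k → k < N)
    {σ : ℕ → ℝ} {τ η : ℝ} (hσ : ∀ k, J k → σ k = τ)
    (hc : ∀ k < N, IntegrableOn (fun x => |Hc k x - σ k * w x|) P ν)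
    (hcη : ∀ k < N, ∫ x in P, |Hc k x - σ k * w x| ∂ν ≤ η)
    (ho : ∀ k < N, IntegrableOn (fun x => |Ho k x|) P ν)
    (hoη : ∀ k < N, ∫ x in P, |Ho k x| ∂ν ≤ η)
    (hw : IntegrableOn w P ν) (hs : IntegrableOn s P ν)
    (hsel : ∀ᵐ x ∂ν, x ∈ P → ∃ k, J k ∧ s x ≤ Hp k x) :
    ∃ s' : α → ℝ, IntegrableOn s' P ν ∧
      (∀ᵐ x ∂ν, x ∈ P → ∃ k, J k ∧ s' x ≤ Hc k x + Ho k x + Hp k x) ∧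
      ∫ x in P, s x ∂ν + τ * ∫ x in P, w x ∂ν - 2 * N * η ≤ ∫ x in P, s' x ∂ν := by
  have hci : IntegrableOn (fun x => ∑ k ∈ Finset.range N, |Hc k x - σ k * w x|) P ν :=
    integrable_finsetSum _ fun k hk => hc k (Finset.mem_range.1 hk)
  have hoi : IntegrableOn (fun x => ∑ k ∈ Finset.range N, |Ho k x|) P ν :=
    integrable_finsetSum _ fun k hk => ho k (Finset.mem_range.1 hk)
  have hsw : IntegrableOn (fun x => s x + τ * w x) P ν := hs.add (hw.const_mul τ)
  have hswc : IntegrableOn (fun x => s x + τ * w x -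
    ∑ k ∈ Finset.range N, |Hc k x - σ k * w x|) P ν := hsw.sub hci
  refine ⟨fun x => s x + τ * w x - (∑ k ∈ Finset.range N, |Hc k x - σ k * w x|)
    - ∑ k ∈ Finset.range N, |Ho k x|, hswc.sub hoi, ?_, ?_⟩
  · filter_upwards [hsel] with x hx hxP
    obtain ⟨k, hk, hle⟩ := hx hxP
    refine ⟨k, hk, ?_⟩
    have hkN := Finset.mem_range.2 (hJ k hk)
    have h1 := Finset.single_le_sum (f := fun k => |Hc k x - σ k * w x|)
      (fun _ _ => abs_nonneg _) hkN
    have h2 := Finset.single_le_sum (f := fun k => |Ho k x|) (fun _ _ => abs_nonneg _) hkN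
    have h3 := neg_abs_le (Hc k x - σ k * w x)
    have h4 := neg_abs_le (Ho k x)
    rw [hσ k hk] at h3
    simp only [hσ k hk] at h1
    linarith
  · have e : ∫ x in P, (s x + τ * w x - (∑ k ∈ Finset.range N, |Hc k x - σ k * w x|)
        - ∑ k ∈ Finset.range N, |Ho k x|) ∂ν
        = ∫ x in P, s x ∂ν + τ * ∫ x in P, w x ∂ν
          - ∑ k ∈ Finset.range N, ∫ x in P, |Hc k x - σ k * w x| ∂ν
          - ∑ k ∈ Finset.range N, ∫ x in P, |Ho k x| ∂ν := by
      rw [← integral_finsetSum _ fun k hk => hc k (Finset.mem_range.1 hk),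
        ← integral_finsetSum _ fun k hk => ho k (Finset.mem_range.1 hk), ← integral_const_mul,
        ← integral_add hs (hw.const_mul τ), ← integral_sub hsw hci, ← integral_sub hswc hoi]
    have h1 := Finset.sum_le_card_nsmul (Finset.range N)
      (fun k => ∫ x in P, |Hc k x - σ k * w x| ∂ν) η fun k hk => hcη k (Finset.mem_range.1 hk)
    have h2 := Finset.sum_le_card_nsmul (Finset.range N)
      (fun k => ∫ x in P, |Ho k x| ∂ν) η fun k hk => hoη k (Finset.mem_range.1 hk)
    rw [Finset.card_range, nsmul_eq_mul] at h1 h2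
    rw [e]
    linarith

/-! ### The tree construction -/

section Tree

open scoped RealInnerProductSpace ContDiff

variable {E : Type*} [NormedAddCommGroup E] [InnerProductSpace ℝ E] [FiniteDimensional ℝ E]
  [MeasurableSpace E] [BorelSpace E]

/-- A smooth real function `f` supported in `O`, built from a binary tree of depth `m` whose leaves
are the directions `v i, …, v (i + 2 ^ m - 1)`. It is bounded by `m` and, up to `ε`, orthogonal
to the given function `h` with square integral at most `m |O|`; its transforms in the directions
`v k`, `k < N`, are small off `O`, and the largest of those in the directions at the leaves
is on average at least `m / 2` on `O`. -/
structure IsTreeFunction (v : ℕ → E) (N : ℕ) (ρ : ℝ) (m i : ℕ) (O : Set E) (h : E → ℝ) (ε : ℝ)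
    (f : E → ℝ) : Prop where
  contDiff : ContDiff ℝ ∞ f
  eq_zero : ∀ x ∉ O, f x = 0
  abs_le : ∀ x, |f x| ≤ m
  integral_sq_le : ∫ x, (h x + f x) ^ 2 ≤ (∫ x, h x ^ 2) + m * volume.real O + ε
  integral_off_le : ∀ k < N, ∫ x in Metric.ball 0 ρ \ O, |lineHilbert (v k) f x| ≤ ε
  exists_selection : ∃ s : E → ℝ, IntegrableOn s O ∧
    (∀ᵐ x, x ∈ O → ∃ k, (i ≤ k ∧ k < i + 2 ^ m) ∧ s x ≤ lineHilbert (v k) f x) ∧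
    m / 2 * volume.real O - ε ≤ ∫ x in O, s x

theorem isTreeFunction_zero (v : ℕ → E) (N : ℕ) (ρ : ℝ) (i : ℕ) (O : Set E) (h : E → ℝ) {ε : ℝ}
    (hε : 0 ≤ ε) : IsTreeFunction v N ρ 0 i O h ε 0 where
  contDiff := contDiff_const
  eq_zero _ _ := rfl
  abs_le _ := by simp
  integral_sq_le := by simp [hε]
  integral_off_le k _ := by simp [lineHilbert_zero, hε]
  exists_selection := ⟨0, integrableOn_zero, Eventually.of_forall fun x _ =>
    ⟨i, ⟨le_rfl, by simp⟩, by simp [lineHilbert_zero]⟩, by simp [hε]⟩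

/-- The properties of the root term `c = g cos (R ⟪μ, ·⟫)` of a tree function, for an amplitude `g`
close to the indicator function of `O` and a frequency `R` large enough. -/
theorem exists_root_term {v : ℕ → E} (hv : ∀ k, ‖v k‖ = 1) (N : ℕ) {ρ : ℝ} (hρ : 0 ≤ ρ) {μ : E}
    (hμ : ∀ k, ⟪μ, v k⟫ ≠ 0) {O : Set E} (hO : IsOpen O) (hOρ : O ⊆ Metric.ball 0 ρ) {h : E → ℝ}
    (hh : Continuous h) {η : ℝ} (hη : 0 < η) :
    ∃ (g : E → ℝ) (R : ℝ), 0 < R ∧ ContDiff ℝ ∞ g ∧ (∀ x ∉ O, g x = 0) ∧ (∀ x, 0 ≤ g x) ∧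
      (∀ x, g x ≤ 1) ∧
      (∀ k < N, ∫ x in Metric.ball (0 : E) ρ,
        |lineHilbert (v k) (fun y => g y * Real.cos (R * ⟪μ, y⟫)) x
          - SignType.sign ⟪μ, v k⟫ * (g x * Real.sin (R * ⟪μ, x⟫))| ≤ η) ∧
      ∫ x, h x * (g x * Real.cos (R * ⟪μ, x⟫)) ≤ η ∧
      volume.real O / 2 - η ≤ ∫ x, g x * Real.sin (R * ⟪μ, x⟫) ^ 2 := by
  have hμ0 : μ ≠ 0 := fun h0 => hμ 0 (by rw [h0, inner_zero_left])
  have hOfin : volume O ≠ ⊤ := ((measure_mono hOρ).trans_lt measure_ball_lt_top).ne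
  obtain ⟨g, hg, hg0, hgnn, hg1, hgint⟩ := exists_contDiff_integral_ge hO hOfin hη
  have hgc : HasCompactSupport g := hasCompactSupport_of_subset_ball hOρ hg0
  have hgi : Integrable g := hg.continuous.integrable_of_hasCompactSupport hgc
  obtain ⟨L, hL⟩ := exists_lipschitzWith_of_subset_ball hOρ hg0 hg
  have hgabs : ∀ y, |g y| ≤ 1 := fun y => by rw [abs_of_nonneg (hgnn y)]; exact hg1 y
  have E1 : ∀ᶠ R : ℝ in atTop, ∀ k ∈ Finset.range N, ∫ x in Metric.ball (0 : E) ρ,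
        |lineHilbert (v k) (fun y => g y * Real.cos (R * ⟪μ, y⟫)) x
          - SignType.sign ⟪μ, v k⟫ * (g x * Real.sin (R * ⟪μ, x⟫))| ≤ η := by
    rw [eventually_all_finset]
    intro k _
    exact ((tendsto_integral_abs_lineHilbert_sub (hv k) hρ
      (fun y hy => apply_eq_zero_of_le_norm hOρ hg0 hy) hL hgabs (hμ k)).eventually_lt_const
        hη).mono fun _ h => h.le
  have hhg : Integrable fun x => h x * g x :=
    (hh.mul hg.continuous).integrable_of_hasCompactSupport hgc.mul_left
  have E2 : ∀ᶠ R : ℝ in atTop, ∫ x, h x * g x * Real.cos (R * ⟪μ, x⟫) ≤ η :=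
    ((tendsto_integral_mul_cos hhg hμ0).eventually_lt_const hη).mono fun _ h => h.le
  have E3 : ∀ᶠ R : ℝ in atTop, ∫ x, g x * Real.cos (2 * R * ⟪μ, x⟫) ≤ η :=
    (((tendsto_integral_mul_cos hgi hμ0).comp
      (tendsto_id.const_mul_atTop two_pos)).eventually_lt_const hη).mono fun _ h => h.le
  obtain ⟨R, h1, h2, h3, hR⟩ := (E1.and (E2.and (E3.and (eventually_gt_atTop 0)))).exists
  refine ⟨g, R, hR, hg, hg0, hgnn, hg1, fun k hk => h1 k (Finset.mem_range.2 hk), ?_, ?_⟩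
  · simpa only [mul_assoc] using h2
  · have hci : Integrable fun x => g x * Real.cos (2 * R * ⟪μ, x⟫) :=
      Integrable.mul_bdd (c := 1) hgi (Continuous.aestronglyMeasurable (by fun_prop))
        (Eventually.of_forall fun t => Real.abs_cos_le_one _)
    have e : ∫ x, g x * Real.sin (R * ⟪μ, x⟫) ^ 2
        = (1 / 2) * (∫ x, g x) - (1 / 2) * ∫ x, g x * Real.cos (2 * R * ⟪μ, x⟫) := by
      rw [← integral_const_mul, ← integral_const_mul,
        ← integral_sub (hgi.const_mul _) (hci.const_mul _)]
      congr 1 with x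
      rw [Real.sin_sq_eq_half_sub, ← mul_assoc 2 R]
      ring
    have e2 : ∫ x in O, g x = ∫ x, g x :=
      setIntegral_eq_integral_of_forall_compl_eq_zero fun x hx => hg0 x hx
    rw [e]
    linarith

theorem integral_add_sq_le {O : Set E} (hOfin : volume O ≠ ⊤)
    {h c : E → ℝ} (hh : Continuous h) (hhc : HasCompactSupport h) (hc : Continuous c)
    (hcc : HasCompactSupport c) (hc0 : ∀ x ∉ O, c x = 0) (hc1 : ∀ x, |c x| ≤ 1) {η : ℝ}
    (horth : ∫ x, h x * c x ≤ η) :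
    ∫ x, (h x + c x) ^ 2 ≤ (∫ x, h x ^ 2) + volume.real O + 2 * η := by
  have i1 : Integrable fun x => h x ^ 2 :=
    (hh.pow 2).integrable_of_hasCompactSupport (by simpa only [pow_two] using hhc.mul_left)
  have i2 : Integrable fun x => h x * c x :=
    (hh.mul hc).integrable_of_hasCompactSupport hcc.mul_left
  have i3 : Integrable fun x => c x ^ 2 :=
    (hc.pow 2).integrable_of_hasCompactSupport (by simpa only [pow_two] using hcc.mul_left)
  have e : ∫ x, (h x + c x) ^ 2
      = (∫ x, h x ^ 2) + 2 * (∫ x, h x * c x) + ∫ x, c x ^ 2 := by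
    have i12 : Integrable fun x => h x ^ 2 + 2 * (h x * c x) := i1.add (i2.const_mul 2)
    rw [← integral_const_mul, ← integral_add i1 (i2.const_mul 2), ← integral_add i12 i3]
    congr 1 with x
    ring
  have hsq : ∫ x, c x ^ 2 ≤ volume.real O := by
    calc ∫ x, c x ^ 2 = ∫ x in O, c x ^ 2 :=
          (setIntegral_eq_integral_of_forall_compl_eq_zero fun x hx => by simp [hc0 x hx]).symm
      _ ≤ ∫ x in O, (1 : ℝ) := by
          refine setIntegral_mono i3.integrableOn (integrableOn_const hOfin) fun x => ?_
          exact (sq_le_one_iff_abs_le_one _).2 (hc1 x)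
      _ = volume.real O := by simp
  rw [e]
  linarith

/-- The inductive step: a root term whose frequency separates the two halves of the directions, and
two trees of depth `m` on the sets where the transforms of the root term in the directions of the
right and of the left half are positive. -/
theorem exists_isTreeFunction_succ {v : ℕ → E} (hv : ∀ k, ‖v k‖ = 1)
    (hsep : ∀ j, ∃ μ : E, (∀ k ≤ j, ⟪μ, v k⟫ < 0) ∧ ∀ k, j < k → 0 < ⟪μ, v k⟫)
    {N : ℕ} {ρ : ℝ} (hρ : 0 ≤ ρ) {m : ℕ}
    (IH : ∀ (i : ℕ), i + 2 ^ m ≤ N → ∀ (O : Set E), IsOpen O → O ⊆ Metric.ball 0 ρ →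
      ∀ (h : E → ℝ), Continuous h → HasCompactSupport h → ∀ ε, 0 < ε →
        ∃ f, IsTreeFunction v N ρ m i O h ε f)
    {i : ℕ} (hi : i + 2 ^ (m + 1) ≤ N) {O : Set E} (hO : IsOpen O) (hOρ : O ⊆ Metric.ball 0 ρ)
    {h : E → ℝ} (hh : Continuous h) (hhc : HasCompactSupport h) {ε : ℝ} (hε : 0 < ε) :
    ∃ f, IsTreeFunction v N ρ (m + 1) i O h ε f := by
  have hpow : 1 ≤ 2 ^ m := Nat.one_le_two_pow
  have hpow' : 2 ^ (m + 1) = 2 ^ m + 2 ^ m := by ring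
  -- the last leaf of the left half has index `i + 2 ^ m - 1`
  obtain ⟨μ, hμneg, hμpos⟩ := hsep (i + 2 ^ m - 1)
  have hμ : ∀ k, ⟪μ, v k⟫ ≠ 0 := fun k => by
    rcases le_or_gt k (i + 2 ^ m - 1) with hk | hk
    · exact (hμneg k hk).ne
    · exact (hμpos k hk).ne'
  have hμ0 : μ ≠ 0 := fun h0 => hμ 0 (by rw [h0, inner_zero_left])
  -- the root and the two subtrees cost at most `4 η`, the errors in the `N` directions `4 N η`
  set η : ℝ := ε / (4 + 4 * N) with hηdef
  have hη : 0 < η := by positivity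
  have hηε : 4 * η + 4 * N * η = ε := by rw [hηdef]; field_simp
  have hNη : 0 ≤ N * η := by positivity
  obtain ⟨g, R, hR, hg, hg0, hgnn, hg1, hroot, horth, hmass⟩ :=
    exists_root_term hv N hρ hμ hO hOρ hh hη
  have hOfin : volume O ≠ ⊤ := ((measure_mono hOρ).trans_lt measure_ball_lt_top).ne
  set c : E → ℝ := fun x => g x * Real.cos (R * ⟪μ, x⟫) with hc
  set w : E → ℝ := fun x => g x * Real.sin (R * ⟪μ, x⟫) with hw
  set σ : ℕ → ℝ := fun k => (SignType.sign ⟪μ, v k⟫ : ℝ) with hσ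
  have hcs : ContDiff ℝ ∞ c := hg.mul (Real.contDiff_cos.comp
    (contDiff_const.mul (contDiff_const.inner ℝ contDiff_id)))
  have hc0 : ∀ x ∉ O, c x = 0 := fun x hx => by simp [hc, hg0 x hx]
  have hw0 : ∀ x ∉ O, w x = 0 := fun x hx => by simp [hw, hg0 x hx]
  have hcc : HasCompactSupport c := hasCompactSupport_of_subset_ball hOρ hc0
  have hwc : HasCompactSupport w := hasCompactSupport_of_subset_ball hOρ hw0
  have hwcont : Continuous w := hg.continuous.mul (by fun_prop)
  have hwi : Integrable w := hwcont.integrable_of_hasCompactSupport hwc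
  have hc1 : ∀ x, |c x| ≤ 1 := fun x => by
    rw [hc, abs_mul, abs_of_nonneg (hgnn x)]
    exact mul_le_one₀ (hg1 x) (abs_nonneg _) (Real.abs_cos_le_one _)
  set P : Set E := O ∩ {x | 0 < Real.sin (R * ⟪μ, x⟫)} with hP
  set Q : Set E := O ∩ {x | Real.sin (R * ⟪μ, x⟫) < 0} with hQ
  have hsinc : Continuous fun x : E => Real.sin (R * ⟪μ, x⟫) := by fun_prop
  have hPo : IsOpen P := hO.inter (isOpen_lt continuous_const hsinc)
  have hQo : IsOpen Q := hO.inter (isOpen_lt hsinc continuous_const)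
  have hPO : P ⊆ O := Set.inter_subset_left
  have hQO : Q ⊆ O := Set.inter_subset_left
  have hPQ : Disjoint P Q := Set.disjoint_left.2 fun x hx hx' =>
    lt_asymm (show 0 < Real.sin (R * ⟪μ, x⟫) from hx.2) hx'.2
  have hPfin : volume P ≠ ⊤ := ((measure_mono hPO).trans_lt hOfin.lt_top).ne
  have hQfin : volume Q ≠ ⊤ := ((measure_mono hQO).trans_lt hOfin.lt_top).ne
  have hvol : volume.real P + volume.real Q = volume.real O := by
    rw [← measureReal_union hPQ hQo.measurableSet hPfin hQfin]
    refine measureReal_congr ?_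
    filter_upwards [ae_sin_inner_ne_zero hμ0 hR.ne'] with x hx
    refine propext ⟨fun hx' => hx'.elim (fun h => hPO h) fun h => hQO h, fun hx' => ?_⟩
    rcases lt_or_gt_of_ne hx with h | h
    · exact Or.inr ⟨hx', h⟩
    · exact Or.inl ⟨hx', h⟩
  -- each subtree is made almost orthogonal to `h` plus all the terms chosen before it
  obtain ⟨f₁, hf₁⟩ := IH i (by omega) Q hQo (hQO.trans hOρ) (fun x => h x + c x)
    (hh.add hcs.continuous) (hhc.add hcc) η hη
  have hf₁O : ∀ x ∉ O, f₁ x = 0 := fun x hx => hf₁.eq_zero x fun hx' => hx (hQO hx')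
  have hf₁c : HasCompactSupport f₁ := hasCompactSupport_of_subset_ball hOρ hf₁O
  obtain ⟨f₂, hf₂⟩ := IH (i + 2 ^ m) (by omega) P hPo (hPO.trans hOρ)
    (fun x => h x + c x + f₁ x) ((hh.add hcs.continuous).add hf₁.contDiff.continuous)
    ((hhc.add hcc).add hf₁c) η hη
  have hf₂O : ∀ x ∉ O, f₂ x = 0 := fun x hx => hf₂.eq_zero x fun hx' => hx (hPO hx')
  have hH : ∀ k x, lineHilbert (v k) (c + f₁ + f₂) x
      = lineHilbert (v k) c x + lineHilbert (v k) f₁ x + lineHilbert (v k) f₂ x := fun k x => by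
    rw [lineHilbert_add_of_subset_ball hOρ (f := c + f₁)
      (fun x hx => by simp [hc0 x hx, hf₁O x hx]) (hcs.add hf₁.contDiff) hf₂O hf₂.contDiff (hv k),
      lineHilbert_add_of_subset_ball hOρ hc0 hcs hf₁O hf₁.contDiff (hv k)]
  have hHc : ∀ k, IntegrableOn (fun x => |lineHilbert (v k) c x - σ k * w x|)
      (Metric.ball 0 ρ) := fun k =>
    ((integrableOn_lineHilbert hρ hOρ hc0 hcs (hv k)).sub
      (hwi.integrableOn.const_mul (σ k))).abs
  have hH₁ : ∀ k, IntegrableOn (fun x => |lineHilbert (v k) f₁ x|) (Metric.ball 0 ρ) := fun k =>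
    (integrableOn_lineHilbert hρ hOρ hf₁O hf₁.contDiff (hv k)).abs
  have hH₂ : ∀ k, IntegrableOn (fun x => |lineHilbert (v k) f₂ x|) (Metric.ball 0 ρ) := fun k =>
    (integrableOn_lineHilbert hρ hOρ hf₂O hf₂.contDiff (hv k)).abs
  have hmono : ∀ {F : E → ℝ} {A B : Set E}, IntegrableOn F B → (∀ x, 0 ≤ F x) → A ⊆ B →
      ∫ x in A, F x ≤ ∫ x in B, F x := fun hF hF0 hAB =>
    setIntegral_mono_set hF (Eventually.of_forall hF0) (Eventually.of_forall hAB)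
  refine ⟨c + f₁ + f₂, ⟨(hcs.add hf₁.contDiff).add hf₂.contDiff, fun x hx => by
    simp [hc0 x hx, hf₁O x hx, hf₂O x hx], fun x => ?_, ?_, fun k hk => ?_, ?_⟩⟩
  · -- at most one of the two subtrees is active at `x`
    have h1 := hf₁.abs_le x
    have h2 := hf₂.abs_le x
    have h3 : f₁ x = 0 ∨ f₂ x = 0 := by
      by_cases hx : x ∈ Q
      · exact Or.inr (hf₂.eq_zero x (Set.disjoint_right.1 hPQ hx))
      · exact Or.inl (hf₁.eq_zero x hx)
    have h4 := hc1 x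
    simp only [Pi.add_apply]
    push_cast
    rcases h3 with h3 | h3
    · rw [h3, add_zero]
      linarith [abs_add_le (c x) (f₂ x)]
    · rw [h3, add_zero]
      linarith [abs_add_le (c x) (f₁ x)]
  · have h1 := hf₁.integral_sq_le
    have h2 := hf₂.integral_sq_le
    have h3 := integral_add_sq_le hOfin hh hhc hcs.continuous hcc hc0 hc1 horth
    have e : ∀ x, h x + (c + f₁ + f₂) x = h x + c x + f₁ x + f₂ x := fun x => by
      simp only [Pi.add_apply]; ring
    simp only [e]
    push_cast
    rw [← hvol] at h3 ⊢
    linarith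
  · have hsub : Metric.ball 0 ρ \ O ⊆ Metric.ball (0 : E) ρ := Set.sdiff_subset
    have h1 : ∫ x in Metric.ball 0 ρ \ O, |lineHilbert (v k) f₁ x| ≤ η :=
      (hmono ((hH₁ k).mono_set Set.sdiff_subset) (fun x => abs_nonneg _)
        (Set.sdiff_subset_sdiff_right hQO)).trans (hf₁.integral_off_le k hk)
    have h2 : ∫ x in Metric.ball 0 ρ \ O, |lineHilbert (v k) f₂ x| ≤ η :=
      (hmono ((hH₂ k).mono_set Set.sdiff_subset) (fun x => abs_nonneg _)
        (Set.sdiff_subset_sdiff_right hPO)).trans (hf₂.integral_off_le k hk)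
    have h3 : ∫ x in Metric.ball 0 ρ \ O, |lineHilbert (v k) c x - σ k * w x| ≤ η :=
      (hmono (hHc k) (fun x => abs_nonneg _) hsub).trans (hroot k hk)
    have i1 := (hH₁ k).mono_set hsub
    have i2 := (hH₂ k).mono_set hsub
    have i3 := (hHc k).mono_set hsub
    have i31 : IntegrableOn (fun x => |lineHilbert (v k) c x - σ k * w x|
      + |lineHilbert (v k) f₁ x|) (Metric.ball 0 ρ \ O) := i3.add i1
    calc ∫ x in Metric.ball 0 ρ \ O, |lineHilbert (v k) (c + f₁ + f₂) x|
        ≤ ∫ x in Metric.ball 0 ρ \ O, (|lineHilbert (v k) c x - σ k * w x|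
          + |lineHilbert (v k) f₁ x| + |lineHilbert (v k) f₂ x|) := by
          refine setIntegral_mono_on ?_ (i31.add i2)
            (Metric.isOpen_ball.measurableSet.diff hO.measurableSet) fun x hx => ?_
          · refine IntegrableOn.mono_set ?_ hsub
            exact (integrableOn_lineHilbert hρ hOρ (fun x hx => by
              simp [hc0 x hx, hf₁O x hx, hf₂O x hx]) ((hcs.add hf₁.contDiff).add hf₂.contDiff)
              (hv k)).abs
          · rw [hH, hw0 x hx.2, mul_zero, sub_zero]
            exact abs_add_three _ _ _
      _ = (∫ x in Metric.ball 0 ρ \ O, |lineHilbert (v k) c x - σ k * w x|)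
          + (∫ x in Metric.ball 0 ρ \ O, |lineHilbert (v k) f₁ x|)
          + ∫ x in Metric.ball 0 ρ \ O, |lineHilbert (v k) f₂ x| := by
          rw [← integral_add i3 i1, ← integral_add i31 i2]
      _ ≤ ε := by linarith
  · obtain ⟨s₁, hs₁, hsel₁, hint₁⟩ := hf₁.exists_selection
    obtain ⟨s₂, hs₂, hsel₂, hint₂⟩ := hf₂.exists_selection
    have hPball := hPO.trans hOρ
    have hQball := hQO.trans hOρ
    have hQoff : Q ⊆ Metric.ball 0 ρ \ P := fun x hx => ⟨hQball hx, Set.disjoint_right.1 hPQ hx⟩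
    have hPoff : P ⊆ Metric.ball 0 ρ \ Q := fun x hx => ⟨hPball hx, Set.disjoint_left.1 hPQ hx⟩
    obtain ⟨t₁, ht₁, hts₁, hti₁⟩ := exists_lower_selection (ν := volume) (P := Q) (N := N)
      (Hc := fun k => lineHilbert (v k) c) (Ho := fun k => lineHilbert (v k) f₂)
      (Hp := fun k => lineHilbert (v k) f₁) (w := w) (s := s₁)
      (J := fun k => i ≤ k ∧ k < i + 2 ^ m) (σ := σ) (τ := -1) (η := η)
      (fun k hk => by omega) (fun k hk => by
        simp only [hσ, sign_neg (hμneg k (by omega)), SignType.coe_neg_one])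
      (fun k _ => (hHc k).mono_set hQball)
      (fun k hk => (hmono (hHc k) (fun x => abs_nonneg _) hQball).trans (hroot k hk))
      (fun k _ => (hH₂ k).mono_set hQball)
      (fun k hk => (hmono ((hH₂ k).mono_set Set.sdiff_subset) (fun x => abs_nonneg _) hQoff).trans
        (hf₂.integral_off_le k hk)) hwi.integrableOn hs₁ hsel₁
    obtain ⟨t₂, ht₂, hts₂, hti₂⟩ := exists_lower_selection (ν := volume) (P := P) (N := N)
      (Hc := fun k => lineHilbert (v k) c) (Ho := fun k => lineHilbert (v k) f₁)
      (Hp := fun k => lineHilbert (v k) f₂) (w := w) (s := s₂)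
      (J := fun k => i + 2 ^ m ≤ k ∧ k < i + 2 ^ m + 2 ^ m) (σ := σ) (τ := 1) (η := η)
      (fun k hk => by omega) (fun k hk => by
        simp only [hσ, sign_pos (hμpos k (by omega)), SignType.coe_one])
      (fun k _ => (hHc k).mono_set hPball)
      (fun k hk => (hmono (hHc k) (fun x => abs_nonneg _) hPball).trans (hroot k hk))
      (fun k _ => (hH₁ k).mono_set hPball)
      (fun k hk => (hmono ((hH₁ k).mono_set Set.sdiff_subset) (fun x => abs_nonneg _) hPoff).trans
        (hf₁.integral_off_le k hk)) hwi.integrableOn hs₂ hsel₂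
    have j₁ : Integrable (Q.indicator t₁) := (integrable_indicator_iff hQo.measurableSet).2 ht₁
    have j₂ : Integrable (P.indicator t₂) := (integrable_indicator_iff hPo.measurableSet).2 ht₂
    refine ⟨fun x => Q.indicator t₁ x + P.indicator t₂ x, (j₁.add j₂).integrableOn, ?_, ?_⟩
    · filter_upwards [hts₁, hts₂, ae_sin_inner_ne_zero hμ0 hR.ne'] with x h1 h2 h3 hx
      rcases lt_or_gt_of_ne h3 with h4 | h4
      · have hxQ : x ∈ Q := ⟨hx, h4⟩
        obtain ⟨k, hk, hle⟩ := h1 hxQ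
        refine ⟨k, ⟨hk.1, by omega⟩, ?_⟩
        rw [Set.indicator_of_mem hxQ, Set.indicator_of_notMem (Set.disjoint_right.1 hPQ hxQ), hH]
        linarith
      · have hxP : x ∈ P := ⟨hx, h4⟩
        obtain ⟨k, hk, hle⟩ := h2 hxP
        refine ⟨k, ⟨by omega, by omega⟩, ?_⟩
        rw [Set.indicator_of_mem hxP, Set.indicator_of_notMem (Set.disjoint_left.1 hPQ hxP), hH]
        linarith
    · have e1 : ∫ x in O, (Q.indicator t₁ x + P.indicator t₂ x)
          = (∫ x in Q, t₁ x) + ∫ x in P, t₂ x := by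
        rw [integral_add j₁.integrableOn j₂.integrableOn, setIntegral_indicator hQo.measurableSet,
          setIntegral_indicator hPo.measurableSet, Set.inter_eq_right.2 hQO,
          Set.inter_eq_right.2 hPO]
      have hq : Integrable fun x => g x * Real.sin (R * ⟪μ, x⟫) ^ 2 := by
        refine (hg.continuous.mul (hsinc.pow 2)).integrable_of_hasCompactSupport ?_
        exact hasCompactSupport_of_subset_ball hOρ fun x hx => by simp [hg0 x hx]
      have e2 : ∫ x, g x * Real.sin (R * ⟪μ, x⟫) ^ 2
          = (∫ x in P, g x * Real.sin (R * ⟪μ, x⟫) ^ 2)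
            + ∫ x in Q, g x * Real.sin (R * ⟪μ, x⟫) ^ 2 := by
        rw [← setIntegral_union hPQ hQo.measurableSet hq.integrableOn hq.integrableOn]
        refine (setIntegral_eq_integral_of_forall_compl_eq_zero fun x hx => ?_).symm
        by_cases hxO : x ∈ O
        · have : Real.sin (R * ⟪μ, x⟫) = 0 := by
            by_contra h0
            rcases lt_or_gt_of_ne h0 with h4 | h4
            · exact hx (Or.inr ⟨hxO, h4⟩)
            · exact hx (Or.inl ⟨hxO, h4⟩)
          rw [this]; ring
        · rw [hg0 x hxO, zero_mul]
      have e3 : ∫ x in P, g x * Real.sin (R * ⟪μ, x⟫) ^ 2 ≤ ∫ x in P, w x := by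
        refine setIntegral_mono_on hq.integrableOn hwi.integrableOn hPo.measurableSet
          fun x hx => mul_le_mul_of_nonneg_left ?_ (hgnn x)
        have h4 : 0 < Real.sin (R * ⟪μ, x⟫) := hx.2
        nlinarith [Real.sin_le_one (R * ⟪μ, x⟫)]
      have e4 : ∫ x in Q, g x * Real.sin (R * ⟪μ, x⟫) ^ 2 ≤ -∫ x in Q, w x := by
        rw [← integral_neg]
        refine setIntegral_mono_on hq.integrableOn hwi.integrableOn.neg hQo.measurableSet
          fun x hx => ?_
        have h4 : Real.sin (R * ⟪μ, x⟫) < 0 := hx.2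
        rw [hw, ← mul_neg]
        refine mul_le_mul_of_nonneg_left ?_ (hgnn x)
        nlinarith [Real.neg_one_le_sin (R * ⟪μ, x⟫)]
      rw [e1]
      push_cast
      rw [← hvol] at hmass ⊢
      linarith

theorem exists_isTreeFunction {v : ℕ → E} (hv : ∀ k, ‖v k‖ = 1)
    (hsep : ∀ j, ∃ μ : E, (∀ k ≤ j, ⟪μ, v k⟫ < 0) ∧ ∀ k, j < k → 0 < ⟪μ, v k⟫)
    {N : ℕ} {ρ : ℝ} (hρ : 0 ≤ ρ) (m : ℕ) :
    ∀ (i : ℕ), i + 2 ^ m ≤ N → ∀ (O : Set E), IsOpen O → O ⊆ Metric.ball 0 ρ →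
      ∀ (h : E → ℝ), Continuous h → HasCompactSupport h → ∀ ε, 0 < ε →
        ∃ f, IsTreeFunction v N ρ m i O h ε f := by
  induction m with
  | zero => exact fun i _ O _ _ h _ _ ε hε => ⟨0, isTreeFunction_zero v N ρ i O h hε.le⟩
  | succ m IH =>
    exact fun i hi O hO hOρ h hh hhc ε hε =>
      exists_isTreeFunction_succ hv hsep hρ IH hi hO hOρ hh hhc hε

end Tree

/-! ### Separated sequences of directions -/

section Directions

open scoped RealInnerProductSpace

variable {n : ℕ}

theorem exists_infinite_inner_pos {U : Set (EuclideanSpace ℝ (Fin n))} (hU : ∀ v ∈ U, ‖v‖ = 1)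
    (hinf : U.Infinite) : ∃ e : EuclideanSpace ℝ (Fin n), {v ∈ U | 0 < ⟪e, v⟫}.Infinite := by
  by_contra! H
  refine hinf ((Set.finite_iUnion fun j : Fin n =>
    (H (EuclideanSpace.single j 1)).union (H (-EuclideanSpace.single j 1))).subset fun v hv => ?_)
  obtain ⟨j, hj⟩ : ∃ j, v j ≠ 0 := by
    by_contra! h0
    have : v = 0 := by ext j; exact h0 j
    simpa [this] using hU v hv
  refine Set.mem_iUnion.2 ⟨j, ?_⟩
  rcases lt_or_gt_of_ne hj with h | h
  · exact Or.inr ⟨hv, by simpa [inner_neg_left, EuclideanSpace.inner_single_left] using h⟩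
  · exact Or.inl ⟨hv, by simpa [EuclideanSpace.inner_single_left] using h⟩

/-- Distinct unit vectors in an open half-space have distinct central projections, so one of the
projective coordinates takes infinitely many values. -/
theorem exists_infinite_image_inner_div {U : Set (EuclideanSpace ℝ (Fin n))}
    (hU : ∀ v ∈ U, ‖v‖ = 1) (hinf : U.Infinite) {e : EuclideanSpace ℝ (Fin n)}
    (he : ∀ v ∈ U, 0 < ⟪e, v⟫) :
    ∃ b : EuclideanSpace ℝ (Fin n), ((fun v => ⟪b, v⟫ / ⟪e, v⟫) '' U).Infinite := by
  by_contra! H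
  have hinj : Set.InjOn (fun v j => v j / ⟪e, v⟫ : EuclideanSpace ℝ (Fin n) → Fin n → ℝ) U := by
    intro v hv u hu huv
    have hs : 0 < ⟪e, v⟫ / ⟪e, u⟫ := div_pos (he v hv) (he u hu)
    have h1 : v = (⟪e, v⟫ / ⟪e, u⟫) • u := by
      ext j
      have h2 := congrFun huv j
      have := (he v hv).ne'
      have := (he u hu).ne'
      simp only [PiLp.smul_apply, smul_eq_mul] at h2 ⊢
      field_simp at h2 ⊢
      linarith
    have h3 := congrArg norm h1
    rw [norm_smul, hU v hv, hU u hu, mul_one, Real.norm_eq_abs, abs_of_pos hs] at h3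
    rw [h1, ← h3, one_smul]
  refine hinf (Set.Finite.of_finite_image ((Set.Finite.pi' fun j : Fin n =>
    H (EuclideanSpace.single j 1)).subset ?_) hinj)
  rintro _ ⟨v, hv, rfl⟩ j
  exact ⟨v, hv, by simp [EuclideanSpace.inner_single_left]⟩

theorem exists_strictMono_inner_div {U : Set (EuclideanSpace ℝ (Fin n))}
    {b e : EuclideanSpace ℝ (Fin n)} (hb : ((fun v => ⟪b, v⟫ / ⟪e, v⟫) '' U).Infinite) :
    ∃ (v : ℕ → EuclideanSpace ℝ (Fin n)) (b' : EuclideanSpace ℝ (Fin n)),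
      (∀ k, v k ∈ U) ∧ StrictMono fun k => ⟪b', v k⟫ / ⟪e, v k⟫ := by
  have a := hb.natEmbedding
  choose u huU hua using fun k => (a k).2
  have hne : ∀ k l, k ≠ l → ⟪b, u k⟫ / ⟪e, u k⟫ ≠ ⟪b, u l⟫ / ⟪e, u l⟫ := fun k l hkl h =>
    hkl (a.injective (Subtype.ext ((hua k).symm.trans (h.trans (hua l)))))
  obtain ⟨g, hg⟩ := exists_increasing_or_nonincreasing_subseq (· < ·)
    fun k => ⟪b, u k⟫ / ⟪e, u k⟫
  rcases hg with hg | hg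
  · exact ⟨fun k => u (g k), b, fun k => huU _, fun k l hkl => hg k l hkl⟩
  · refine ⟨fun k => u (g k), -b, fun k => huU _, fun k l hkl => ?_⟩
    have h1 := lt_of_le_of_ne (not_lt.1 (hg k l hkl))
      (hne _ _ fun h => hkl.ne' (g.injective h))
    simp only [inner_neg_left, neg_div]
    exact neg_lt_neg h1

/-- An infinite set of unit vectors contains a sequence each of whose cuts into an initial part and
the rest is realised by a hyperplane. -/
theorem exists_separated_directions {U : Set (EuclideanSpace ℝ (Fin n))}
    (hU : ∀ v ∈ U, ‖v‖ = 1) (hinf : U.Infinite) :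
    ∃ v : ℕ → EuclideanSpace ℝ (Fin n), (∀ k, v k ∈ U) ∧
      ∀ j, ∃ μ : EuclideanSpace ℝ (Fin n),
        (∀ k ≤ j, ⟪μ, v k⟫ < 0) ∧ ∀ k, j < k → 0 < ⟪μ, v k⟫ := by
  obtain ⟨e, he⟩ := exists_infinite_inner_pos hU hinf
  obtain ⟨b, hb⟩ := exists_infinite_image_inner_div (fun v hv => hU v hv.1) he fun v hv => hv.2
  obtain ⟨v, b', hvU, hmono⟩ := exists_strictMono_inner_div hb
  refine ⟨v, fun k => (hvU k).1, fun j => ?_⟩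
  set r : ℕ → ℝ := fun k => ⟪b', v k⟫ / ⟪e, v k⟫ with hr
  have hrj : r j < r (j + 1) := hmono j.lt_succ_self
  have hpos : ∀ k, 0 < ⟪e, v k⟫ := fun k => (hvU k).2
  have key : ∀ k, ⟪b' - ((r j + r (j + 1)) / 2) • e, v k⟫
      = (r k - (r j + r (j + 1)) / 2) * ⟪e, v k⟫ := fun k => by
    have := (hpos k).ne'
    rw [inner_sub_left, real_inner_smul_left, sub_mul, hr]
    simp only
    rw [div_mul_cancel₀ _ this]
  refine ⟨b' - ((r j + r (j + 1)) / 2) • e, fun k hk => ?_, fun k hk => ?_⟩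
  · rw [key]
    have : r k ≤ r j := hmono.monotone hk
    exact mul_neg_of_neg_of_pos (by linarith) (hpos k)
  · rw [key]
    have : r (j + 1) ≤ r k := hmono.monotone hk
    exact mul_pos (by linarith) (hpos k)

end Directions

/-! ### Comparison of the norms -/

/-- A function bounded by `m` with square integral `O(m)` has `L^q` norm `o(m)` for every finite
`q`: it exceeds `δ m` only on a set of measure `O(1 / (δ ^ 2 m))`. -/
theorem integral_rpow_abs_le {α : Type*} [MeasurableSpace α] {ν : Measure α} {O : Set α}
    (hfin : ν O ≠ ⊤) {f : α → ℝ} (hf0 : ∀ x ∉ O, f x = 0)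
    {M : ℝ} (hM : 0 < M) (hfM : ∀ x, |f x| ≤ M) (hfi : Integrable (fun x => f x ^ 2) ν)
    (hsq : ∫ x, f x ^ 2 ∂ν ≤ 2 * M * ν.real O) {q : ℝ} (hq : 0 < q) {δ : ℝ} (hδ : 0 < δ) :
    ∫ x, |f x| ^ q ∂ν ≤ M ^ q * ((δ ^ q + 2 / (M * δ ^ 2)) * ν.real O) := by
  have hpt : ∀ x, |f x| ^ q ≤ M ^ q * (δ ^ q + f x ^ 2 / (M * δ) ^ 2) := by
    intro x
    have h0 : 0 ≤ |f x| / M := by positivity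
    have e : |f x| ^ q = M ^ q * (|f x| / M) ^ q := by
      rw [← Real.mul_rpow hM.le h0, mul_div_cancel₀ _ hM.ne']
    rw [e]
    refine mul_le_mul_of_nonneg_left ?_ (by positivity)
    rcases le_or_gt (|f x| / M) δ with h | h
    · have := Real.rpow_le_rpow h0 h hq.le
      have : 0 ≤ f x ^ 2 / (M * δ) ^ 2 := by positivity
      linarith
    · have h1 : (|f x| / M) ^ q ≤ 1 :=
        Real.rpow_le_one h0 ((div_le_one hM).2 (hfM x)) hq.le
      have h2 : 1 ≤ f x ^ 2 / (M * δ) ^ 2 := by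
        rw [one_le_div (by positivity), ← sq_abs (f x)]
        rw [lt_div_iff₀ hM] at h
        exact pow_le_pow_left₀ (by positivity) (by linarith) 2
      have : 0 ≤ δ ^ q := by positivity
      linarith
  have hi1 : IntegrableOn (fun _ => δ ^ q) O ν := integrableOn_const hfin
  have hi2 : IntegrableOn (fun x => f x ^ 2 / (M * δ) ^ 2) O ν := (hfi.div_const _).integrableOn
  have hbi : IntegrableOn (fun x => M ^ q * (δ ^ q + f x ^ 2 / (M * δ) ^ 2)) O ν :=
    (hi1.add hi2).const_mul _
  have hO2 : ∫ x in O, f x ^ 2 ∂ν = ∫ x, f x ^ 2 ∂ν :=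
    setIntegral_eq_integral_of_forall_compl_eq_zero fun x hx => by simp [hf0 x hx]
  calc ∫ x, |f x| ^ q ∂ν = ∫ x in O, |f x| ^ q ∂ν :=
        (setIntegral_eq_integral_of_forall_compl_eq_zero fun x hx => by
          simp [hf0 x hx, Real.zero_rpow hq.ne']).symm
    _ ≤ ∫ x in O, M ^ q * (δ ^ q + f x ^ 2 / (M * δ) ^ 2) ∂ν :=
        integral_mono_of_nonneg (Eventually.of_forall fun x => by positivity) hbi
          (Eventually.of_forall hpt)
    _ = M ^ q * (δ ^ q * ν.real O + (∫ x, f x ^ 2 ∂ν) / (M * δ) ^ 2) := by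
        rw [integral_const_mul, integral_add hi1 hi2, setIntegral_const, integral_div, hO2,
          smul_eq_mul, mul_comm (ν.real O)]
    _ ≤ M ^ q * (δ ^ q * ν.real O + (2 * M * ν.real O) / (M * δ) ^ 2) := by gcongr
    _ = M ^ q * ((δ ^ q + 2 / (M * δ ^ 2)) * ν.real O) := by
        field_simp

/-- Hölder's inequality on a set of finite measure, for an element of `L^p`. -/
theorem integral_norm_le_norm_mul {α : Type*} [MeasurableSpace α] {ν : Measure α} {O : Set α}
    (hfin : ν O ≠ ⊤) {p : ℝ≥0∞} (hp1 : 1 ≤ p) (hp : p ≠ ⊤) (G : Lp ℂ p ν) :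
    IntegrableOn (fun x => ‖G x‖) O ν ∧
      ∫ x in O, ‖G x‖ ∂ν ≤ ‖G‖ * ν.real O ^ (1 - 1 / p.toReal) := by
  have : IsFiniteMeasure (ν.restrict O) := ⟨by rw [Measure.restrict_apply_univ]; exact hfin.lt_top⟩
  have hG : MemLp G p (ν.restrict O) := (Lp.memLp G).restrict O
  have hG1 : Integrable G (ν.restrict O) := hG.integrable hp1
  refine ⟨hG1.norm, ?_⟩
  have h := eLpNorm_le_eLpNorm_mul_rpow_measure_univ hp1 hG.aestronglyMeasurable
  have h2 : eLpNorm G p (ν.restrict O) ≤ eLpNorm G p ν := eLpNorm_mono_measure _ Measure.restrict_le_self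
  have hpp : 0 ≤ 1 - 1 / p.toReal := by
    have h1 : 1 ≤ p.toReal := by
      rw [← ENNReal.toReal_one]
      exact ENNReal.toReal_mono hp hp1
    have := (div_le_one (by linarith : 0 < p.toReal)).2 h1
    linarith
  rw [integral_norm_eq_lintegral_enorm hG1.aestronglyMeasurable, ← eLpNorm_one_eq_lintegral_enorm,
    Lp.norm_def, Measure.real, ENNReal.toReal_rpow, ← ENNReal.toReal_mul]
  refine ENNReal.toReal_mono ?_ (h.trans ?_)
  · have := Lp.eLpNorm_ne_top G
    have := ENNReal.rpow_ne_top_of_nonneg hpp hfin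
    finiteness
  · rw [Measure.restrict_apply_univ, ENNReal.toReal_one, div_one]
    gcongr

section Final

open scoped ContDiff

variable {n : ℕ}

theorem norm_toLp_eq {p : ℝ≥0∞} (hp0 : p ≠ 0) (hp : p ≠ ⊤) (F : 𝓢(EuclideanSpace ℝ (Fin n), ℂ)) :
    ‖(F.memLp p volume).toLp F‖ = (∫ x, ‖F x‖ ^ p.toReal) ^ (1 / p.toReal) := by
  rw [Lp.norm_toLp, (F.memLp p volume).eLpNorm_eq_integral_rpow_norm hp0 hp,
    ENNReal.toReal_ofReal (by positivity), one_div]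

theorem abs_lineHilbert_le_maximal {U : Set (EuclideanSpace ℝ (Fin n))}
    {f : EuclideanSpace ℝ (Fin n) → ℝ} {ρ : ℝ} (hf : ∀ y, ρ ≤ ‖y‖ → f y = 0) {L : NNReal}
    (hL : LipschitzWith L f) {F : 𝓢(EuclideanSpace ℝ (Fin n), ℂ)} (hF : ∀ y, F y = (f y : ℂ))
    {x : EuclideanSpace ℝ (Fin n)} (hx : maximalDirectionalHilbert U F x ≠ ⊤)
    {v : EuclideanSpace ℝ (Fin n)} (hvU : v ∈ U) (hv : ‖v‖ = 1) :
    |lineHilbert v f x| ≤ (maximalDirectionalHilbert U F x).toReal := by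
  have h : ‖directionalHilbert v F x‖ₑ ≤ maximalDirectionalHilbert U F x :=
    le_iSup₂ (f := fun v (_ : v ∈ U) => ‖directionalHilbert v F x‖ₑ) v hvU
  have h2 := ENNReal.toReal_mono hx h
  rwa [toReal_enorm, directionalHilbert_eq_lineHilbert hv hf hL F hF, Complex.norm_real,
    Real.norm_eq_abs] at h2

/-- The tree function of depth `m` in the unit ball: its maximal transform has average at least
`m / 4` there, while its `L^q` norms are `o(m)` because `δ` is arbitrary. The maximal transform is
bounded below through a minorant `s`, which avoids the question of its measurability. -/
theorem exists_schwartz_maximal_large {U : Set (EuclideanSpace ℝ (Fin n))}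
    (hU : ∀ v ∈ U, ‖v‖ = 1) (hinf : U.Infinite) {m : ℕ} (hm : 0 < m) :
    ∃ F : 𝓢(EuclideanSpace ℝ (Fin n), ℂ),
      (∀ {q δ : ℝ}, 0 < q → 0 < δ → ∫ x, ‖F x‖ ^ q ≤ (m : ℝ) ^ q *
        ((δ ^ q + 2 / (m * δ ^ 2)) * volume.real (Metric.ball (0 : EuclideanSpace ℝ (Fin n)) 1))) ∧
      ∃ s : EuclideanSpace ℝ (Fin n) → ℝ, IntegrableOn s (Metric.ball 0 1) ∧
        (∀ᵐ x, x ∈ Metric.ball (0 : EuclideanSpace ℝ (Fin n)) 1 →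
          maximalDirectionalHilbert U F x ≠ ⊤ →
            s x ≤ (maximalDirectionalHilbert U F x).toReal) ∧
        m / 4 * volume.real (Metric.ball (0 : EuclideanSpace ℝ (Fin n)) 1)
          ≤ ∫ x in Metric.ball 0 1, s x := by
  obtain ⟨v, hvU, hsep⟩ := exists_separated_directions hU hinf
  have hv : ∀ k, ‖v k‖ = 1 := fun k => hU _ (hvU k)
  set O : Set (EuclideanSpace ℝ (Fin n)) := Metric.ball 0 1 with hO
  have hm' : (0 : ℝ) < m := by exact_mod_cast hm
  have hβ : 0 < volume.real O :=
    ENNReal.toReal_pos (Metric.measure_ball_pos volume _ one_pos).ne' measure_ball_lt_top.ne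
  obtain ⟨f, hf⟩ := exists_isTreeFunction hv hsep (N := 2 ^ m) zero_le_one m 0 (by simp) O
    Metric.isOpen_ball (Set.Subset.refl _) (fun _ => 0) continuous_const HasCompactSupport.zero
    (m / 4 * volume.real O) (by positivity)
  have hfc : HasCompactSupport f := hasCompactSupport_of_subset_ball (Set.Subset.refl _) hf.eq_zero
  obtain ⟨L, hL⟩ := exists_lipschitzWith_of_subset_ball (Set.Subset.refl _) hf.eq_zero hf.contDiff
  have hfz : ∀ y, 1 ≤ ‖y‖ → f y = 0 := fun y hy =>
    apply_eq_zero_of_le_norm (Set.Subset.refl _) hf.eq_zero hy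
  have hFc : HasCompactSupport fun x => (f x : ℂ) := hfc.comp_left Complex.ofReal_zero
  have hFs : ContDiff ℝ ∞ fun x => (f x : ℂ) := Complex.ofRealCLM.contDiff.comp hf.contDiff
  have hF : ∀ y, hFc.toSchwartzMap hFs y = (f y : ℂ) := fun y => rfl
  refine ⟨hFc.toSchwartzMap hFs, fun {q δ} hq hδ => ?_, ?_⟩
  · simp only [hF, Complex.norm_real, Real.norm_eq_abs]
    refine integral_rpow_abs_le measure_ball_lt_top.ne hf.eq_zero
      hm' hf.abs_le ?_ ?_ hq hδ
    · exact (hf.contDiff.continuous.pow 2).integrable_of_hasCompactSupport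
        (by simpa only [pow_two] using hfc.mul_left)
    · have := hf.integral_sq_le
      simp only [zero_add, ne_eq, OfNat.ofNat_ne_zero, not_false_eq_true, zero_pow,
        integral_zero] at this
      have hmβ : 0 < m * volume.real O := by positivity
      linarith
  · obtain ⟨s, hs, hsel, hint⟩ := hf.exists_selection
    refine ⟨s, hs, ?_, by linarith⟩
    filter_upwards [hsel] with x hx hxO hfin
    obtain ⟨k, -, hk⟩ := hx hxO
    exact hk.trans ((le_abs_self _).trans
      (abs_lineHilbert_le_maximal hfz hL hF hfin (hvU k) (hv k)))

end Final

theorem theorem2 (n : ℕ) (hn : 2 ≤ n) (U : Set (EuclideanSpace ℝ (Fin n)))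
    (hU : ∀ v ∈ U, ‖v‖ = 1) (hUinf : U.Infinite) (p : ℝ≥0∞) (hp1 : 1 < p) (hp : p < ∞) :
    ¬ ExtendsToBoundedOperator U p := by
  rintro ⟨T, ⟨C₀, hC₀⟩, hT⟩
  set C : ℝ := max C₀ 0
  have hC0 : 0 ≤ C := le_max_right _ _
  have hC : ∀ g, ‖T g‖ ≤ C * ‖g‖ := fun g =>
    (hC₀ g).trans (mul_le_mul_of_nonneg_right (le_max_left _ _) ENNReal.toReal_nonneg)
  set β : ℝ := volume.real (Metric.ball (0 : EuclideanSpace ℝ (Fin n)) 1)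
  have hβ : 0 < β :=
    ENNReal.toReal_pos (Metric.measure_ball_pos volume _ one_pos).ne' measure_ball_lt_top.ne
  set q : ℝ := p.toReal
  have hq1 : 1 < q := by
    have := (ENNReal.toReal_lt_toReal ENNReal.one_ne_top hp.ne).2 hp1
    rwa [ENNReal.toReal_one] at this
  have hq : 0 < q := by linarith
  have main : ∀ m : ℕ, 0 < m → ∀ δ : ℝ, 0 < δ →
      1 / 4 ≤ C * (δ ^ q + 2 / (m * δ ^ 2)) ^ (1 / q) := by
    intro m hm δ hδ
    have hm' : (0 : ℝ) < m := by exact_mod_cast hm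
    obtain ⟨F, hFq, s, hs, hsle, hsint⟩ := exists_schwartz_maximal_large hU hUinf hm
    have hA : 0 ≤ δ ^ q + 2 / (m * δ ^ 2) := by positivity
    obtain ⟨hTi, hTint⟩ := integral_norm_le_norm_mul (O := Metric.ball 0 1)
      measure_ball_lt_top.ne hp1.le hp.ne (T ((F.memLp p volume).toLp F))
    have h1 : ∫ x in Metric.ball 0 1, s x
        ≤ ∫ x in Metric.ball 0 1, ‖T ((F.memLp p volume).toLp F) x‖ := by
      refine setIntegral_mono_on_ae hs hTi Metric.isOpen_ball.measurableSet ?_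
      filter_upwards [hT F, hsle] with x hx h hxO
      rw [hx.2, Complex.norm_real, Real.norm_eq_abs]
      exact (h hxO hx.1).trans (le_abs_self _)
    have h2 : ‖(F.memLp p volume).toLp F‖
        ≤ m * ((δ ^ q + 2 / (m * δ ^ 2)) ^ (1 / q) * β ^ (1 / q)) := by
      rw [norm_toLp_eq (by positivity) hp.ne]
      refine (Real.rpow_le_rpow (by positivity) (hFq hq hδ) (by positivity)).trans (le_of_eq ?_)
      rw [Real.mul_rpow (by positivity) (by positivity), Real.mul_rpow hA hβ.le, ← Real.rpow_mul
        hm'.le, mul_one_div_cancel hq.ne', Real.rpow_one]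
    have h3 : m / 4 * β ≤ C * (m * ((δ ^ q + 2 / (m * δ ^ 2)) ^ (1 / q) * β ^ (1 / q)))
        * β ^ (1 - 1 / q) :=
      hsint.trans (h1.trans (hTint.trans (mul_le_mul_of_nonneg_right
        ((hC _).trans (mul_le_mul_of_nonneg_left h2 hC0)) (by positivity))))
    have h4 : β ^ (1 / q) * β ^ (1 - 1 / q) = β := by
      rw [← Real.rpow_add hβ, add_sub_cancel, Real.rpow_one]
    have h5 : C * (m * ((δ ^ q + 2 / (m * δ ^ 2)) ^ (1 / q) * β ^ (1 / q))) * β ^ (1 - 1 / q)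
        = (C * (δ ^ q + 2 / (m * δ ^ 2)) ^ (1 / q)) * (m * β) := by
      calc _ = (C * (δ ^ q + 2 / (m * δ ^ 2)) ^ (1 / q)) * (m * (β ^ (1 / q) * β ^ (1 - 1 / q))) := by
            ring
        _ = _ := by rw [h4]
    rw [h5] at h3
    have hmβ : 0 < m * β := by positivity
    refine le_of_mul_le_mul_right ?_ hmβ
    linarith
  -- let `m → ∞` and then `δ → 0`
  have hlim : ∀ δ : ℝ, 0 < δ → 1 / 4 ≤ C * δ := by
    intro δ hδ
    have ht : Tendsto (fun m : ℕ => C * (δ ^ q + 2 / (m * δ ^ 2)) ^ (1 / q)) atTop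
        (𝓝 (C * (δ ^ q + 0) ^ (1 / q))) := by
      refine Tendsto.const_mul _ (Tendsto.rpow_const (tendsto_const_nhds.add ?_)
        (Or.inr (by positivity)))
      exact tendsto_const_nhds.div_atTop
        (tendsto_natCast_atTop_atTop.atTop_mul_const (by positivity))
    rw [add_zero, ← Real.rpow_mul hδ.le, mul_one_div_cancel hq.ne', Real.rpow_one] at ht
    refine ge_of_tendsto ht ?_
    filter_upwards [eventually_gt_atTop 0] with m hm using main m hm δ hδ
  have h := hlim (1 / (4 * (C + 1))) (by positivity)
  have : C * (1 / (4 * (C + 1))) < 1 / 4 := by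
    rw [mul_one_div, div_lt_div_iff₀ (by positivity) (by norm_num)]
    linarith
  linarith
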